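/- Let $q\equiv 1 \pmod 4$ be a prime power, let $n\ge 1$, and let $V$ be a $2n$-dimensional vector space over $\mathbb F_q$ with a nondegenerate alternating bilinear form $B$. Let $\mathcal V$ be the set of subspaces $X\le V$ with $X^\perp=X$ (each has dimension $n$). The dual polar graph $\Gamma$ on $\mathcal V$ joins $X$ and $Y$ when $X\cap Y$ has codimension $1$ in both; write $d$ for its distance. For each $X\in\mathcal V$ fix a nonzero alternating $n$-linear form $\delta_X:X^n\to\mathbb F_q$. For $X,Y\in\mathcal V$ let $k$ be the codimension of $X\cap Y$ in $X$ and in $Y$, choose bases $x_1,\dots,x_n$ of $X$ and $y_1,\dots,y_n$ of $Y$ such that $x_i=y_i$ for $k<i\le n$ and these vectors form a basis of $X\cap Y$, and put $$\sigma(X,Y)=\chi\bigl(\delta_X(x_1,\dots,x_n)\,\delta_Y(y_1,\dots,y_n)\,\det[B(x_i,y_j)]_{1\le i,j\le k}\bigr)\in\{\pm1\},$$ where $\chi$ is the quadratic character of $\mathbb F_q$ (the value does not depend on the chosen bases). On $\mathcal V\times\{\pm1\}$ define, for $0\le k\le n$, $$R_k=\{((X,\varepsilon),(Y,\varepsilon')):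 d(X,Y)=k,\ \varepsilon\varepsilon'=\sigma(X,Y)\},$$ $$R_{2n+1-k}=\{((X,\varepsilon),(Y,\varepsilon')): d(X,Y)=k,\ \varepsilon\varepsilon'=-\sigma(X,Y)\}.$$ A $Q$-polynomial ordering of a symmetric $D$-class association scheme is an enumeration $E_0,\dots,E_D$ of the primitive idempotents of its Bose–Mesner algebra such that, for every $j$, $E_j$ is a polynomial of degree exactly $j$ in $E_1$ with respect to entrywise multiplication; a scheme is $Q$-polynomial if it has such an ordering. **Theorem.** The relations $R_0,\dots,R_{2n+1}$ form a symmetric $(2n+1)$-class association scheme $\mathcal S_{n,q}$ on $\mathcal V\times\{\pm1\}$. This scheme is $Q$-polynomial, and it has two distinct $Q$-polynomial orderings. More precisely, for $r=\sqrt q$ and for $r=-\sqrt q$ put $\sigma_j=r^{-j}$ for $0\le j\le n$ and $\sigma_j=-r^{-(2n+1-j)}$ for $n+1\le j\le 2n+1$; then for each of the two values of $r$ there is a $Q$-polynomial ordering whose idempotent $E_1$ satisfies $(E_1)_{a,b}=(E_1)_{a,a}\,\sigma_k$ for all $(a,b)\in R_k$, $0\le k\le 2n+1$, and these two orderings are distinct.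 -/

import Mathlib

/-! ### Symmetric association schemes and the `Q`-polynomial property -/

section Scheme

variable {Ω : Type*} {d : ℕ}

/-- `R 0, …, R d` are the relations of a symmetric `d`-class association scheme on `Ω`:
they are nonempty and partition `Ω × Ω`, `R 0` is the identity relation, each `R i` is symmetric,
and the intersection numbers `p i j k` are well defined. -/
structure IsAssociationScheme (R : Fin (d + 1) → Ω → Ω → Prop) : Prop where
  finite : Finite Ω
  nonempty : ∀ i, ∃ x y, R i x y
  partition : ∀ x y, ∃! i, R i x y
  identity : ∀ x y, R 0 x y ↔ x = y
  symmetric : ∀ i x y, R i x y → R i y x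
  intersection : ∀ i j k, ∃ p : ℕ, ∀ x y, R k x y → {z | R i x z ∧ R j z y}.ncard = p

open scoped Classical in
/-- The adjacency matrix of the `i`-th relation. -/
noncomputable def adjacencyMatrix (R : Fin (d + 1) → Ω → Ω → Prop) (i : Fin (d + 1)) :
    Matrix Ω Ω ℝ :=
  Matrix.of fun x y => if R i x y then 1 else 0

/-- The (underlying space of the) Bose-Mesner algebra: the span of the adjacency matrices. -/
noncomputable def boseMesner (R : Fin (d + 1) → Ω → Ω → Prop) : Submodule ℝ (Matrix Ω Ω ℝ) :=
  Submodule.span ℝ (Set.range (adjacencyMatrix R))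

open scoped Classical in
/-- `E 0, …, E d` is an enumeration of the primitive idempotents of the Bose-Mesner algebra:
`d + 1` nonzero, mutually orthogonal idempotents of the algebra with sum `I`. (The algebra of a
`d`-class scheme is commutative of dimension `d + 1`, so such idempotents are exactly the
primitive ones, each listed once.) -/
structure IsIdempotentOrdering [Fintype Ω] (R : Fin (d + 1) → Ω → Ω → Prop)
    (E : Fin (d + 1) → Matrix Ω Ω ℝ) : Prop where
  mem : ∀ j, E j ∈ boseMesner R
  ne_zero : ∀ j, E j ≠ 0
  idem : ∀ j, E j * E j = E j
  orthogonal : ∀ i j, i ≠ j → E i * E j = 0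
  sum_eq_one : ∑ j, E j = 1

/-- A `Q`-polynomial ordering: an enumeration of the primitive idempotents such that `E j` is a
polynomial of degree `j` in `E 1` with respect to entrywise multiplication. -/
def IsQPolynomialOrdering [Fintype Ω] (R : Fin (d + 1) → Ω → Ω → Prop)
    (E : Fin (d + 1) → Matrix Ω Ω ℝ) : Prop :=
  IsIdempotentOrdering R E ∧
    ∀ j : Fin (d + 1), ∃ f : Polynomial ℝ, f.degree = ((j : ℕ) : WithBot ℕ) ∧
      E j = (E 1).map fun t => f.eval t

/-- A scheme is `Q`-polynomial if it has a `Q`-polynomial ordering. -/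
def IsQPolynomial [Fintype Ω] (R : Fin (d + 1) → Ω → Ω → Prop) : Prop :=
  ∃ E : Fin (d + 1) → Matrix Ω Ω ℝ, IsQPolynomialOrdering R E

end Scheme

/-! ### Dual polar graphs of symplectic type and the Maslov index -/

section DualPolar

variable {F V : Type*} [Field F] [AddCommGroup V] [Module F V]

/-- The generators: subspaces `X` of `V` with `X^⊥ = X`. -/
def Generator (B : LinearMap.BilinForm F V) : Type _ :=
  {X : Submodule F V // B.orthogonal X = X}

instance Generator.instFinite (B : LinearMap.BilinForm F V) [Finite F] [FiniteDimensional F V] :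
    Finite (Generator B) := by
  have : Finite V := Module.finite_of_finite F
  have : Finite (Submodule F V) := Finite.of_injective _ SetLike.coe_injective
  exact Subtype.finite

noncomputable instance Generator.instFintype (B : LinearMap.BilinForm F V) [Finite F]
    [FiniteDimensional F V] : Fintype (Generator B) :=
  Fintype.ofFinite _

variable {B : LinearMap.BilinForm F V}

/-- The codimension of `X ∩ Y` in `X`. -/
noncomputable def codimInter (X Y : Generator B) : ℕ :=
  Module.finrank F X.1 - Module.finrank F (X.1 ⊓ Y.1 : Submodule F V)

/-- The dual polar graph: `X` and `Y` are adjacent when `X ∩ Y` has codimension one in both. -/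
def dualPolarGraph (B : LinearMap.BilinForm F V) : SimpleGraph (Generator B) where
  Adj X Y := codimInter X Y = 1 ∧ codimInter Y X = 1
  symm := ⟨fun _ _ h => ⟨h.2, h.1⟩⟩
  loopless := ⟨fun X h => by
    have h' := h.1
    rw [codimInter, inf_idem, Nat.sub_self] at h'
    exact absurd h' (by decide)⟩

/-- With `k` the codimension of `X ∩ Y`: bases `x₀, …, xₙ₋₁` of `X` and `y₀, …, yₙ₋₁` of `Y`
such that `x i = y i` for `i ≥ k`, and these vectors form a basis of `X ∩ Y`. -/
def IsAdapted {n : ℕ} {X Y : Generator B} (x : Module.Basis (Fin n) F X.1)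
    (y : Module.Basis (Fin n) F Y.1) : Prop :=
  (∀ i : Fin n, codimInter X Y ≤ (i : ℕ) → (x i : V) = (y i : V)) ∧
    Submodule.span F {v : V | ∃ i : Fin n, codimInter X Y ≤ (i : ℕ) ∧ (x i : V) = v} = X.1 ⊓ Y.1

/-- `δ_X(x₁, …, xₙ) δ_Y(y₁, …, yₙ) det [B(x_i, y_j)]`, the determinant being over the first `k`
indices, with `k` the codimension of `X ∩ Y`. -/
noncomputable def maslovValue {n : ℕ} (δ : (X : Generator B) → X.1 [⋀^Fin n]→ₗ[F] F)
    {X Y : Generator B} (x : Module.Basis (Fin n) F X.1) (y : Module.Basis (Fin n) F Y.1) : F :=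
  δ X x * δ Y y *
    (Matrix.of fun i j : {i : Fin n // (i : ℕ) < codimInter X Y} =>
      B (x i.1 : V) (y j.1 : V)).det

open scoped Classical in
/-- The Maslov index `σ(X, Y) = χ(δ_X(x) δ_Y(y) det [B(x_i, y_j)]) ∈ {±1}` for the determinant
functions `δ`, with `χ` the quadratic character; the value of `χ` is the same for all adapted
pairs of bases, so that `σ(X, Y) = 1` exactly when it is `1` for one of them. -/
noncomputable def maslov [Fintype F] {n : ℕ} (δ : (X : Generator B) → X.1 [⋀^Fin n]→ₗ[F] F)
    (X Y : Generator B) : ℤˣ :=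
  if ∃ (x : Module.Basis (Fin n) F X.1) (y : Module.Basis (Fin n) F Y.1),
      IsAdapted x y ∧ quadraticChar F (maslovValue δ x y) = 1
  then 1 else -1

/-- The relations of the scheme on `𝒱 × {±1}`. For `k ≤ n`, the relation `R k` holds when
`d(X, Y) = k` and `ε ε' = σ(X, Y)`, and the relation `R (2n+1-k)` holds when `d(X, Y) = k` and
`ε ε' = -σ(X, Y)`; here `d` is the distance in the dual polar graph. -/
def schemeRel [Fintype F] {n : ℕ} (δ : (X : Generator B) → X.1 [⋀^Fin n]→ₗ[F] F)
    (i : Fin (2 * n + 1 + 1)) (a b : Generator B × ℤˣ) : Prop :=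
  ∃ k : ℕ, k ≤ n ∧ (dualPolarGraph B).dist a.1 b.1 = k ∧
    (((i : ℕ) = k ∧ a.2 * b.2 = maslov δ a.1 b.1) ∨
      ((i : ℕ) = 2 * n + 1 - k ∧ a.2 * b.2 = -maslov δ a.1 b.1))

end DualPolar

/-- The sequence `1, r⁻¹, …, r⁻ⁿ, -r⁻ⁿ, …, -r⁻¹, -1` of length `2n+2`. -/
noncomputable def qSequence (n : ℕ) (r : ℝ) (j : ℕ) : ℝ :=
  if j ≤ n then (r ^ j)⁻¹ else -(r ^ (2 * n + 1 - j))⁻¹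

/-! ### Orthogonalising the entrywise powers of a symmetric matrix -/

section FlagOfIdeals

open Polynomial Matrix

variable {Ω : Type*} {d : ℕ}

/-! Fix r with r² = q and let S have the entry εε'σ(X,Y) r^{-d(X,Y)} at ((X,ε),(Y,ε')). It takes the
value σ_k on R_k, and these 2n+2 values are distinct, so by interpolation the entrywise powers of S
with exponent at most 2n+1 span the Bose–Mesner space. Let W_m be the span of the powers with
exponent below m.

The heart of the matter is that every W_m is stable under left multiplication by the Bose–Mesner
space. This space lies in the algebra generated by four matrices on the double cover: unsigned and
signed by σ, supported on distance 0 or 1. Signed times unsigned is zero, by cancellation between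
the two sheets. The rest is a count of the neighbours Z = (X ∩ v^⊥) + ⟨v⟩ of X, with v outside X and
k = d(X,Y). If v is not in X + Y = (X ∩ Y)^⊥, then Z is farther from Y; if v = x + y with y in Y and
B(x,y) = 0, it is closer; in both cases σ(X,Z)σ(Z,Y) = σ(X,Y). If B(x,y) ≠ 0, the distance stays k
and the product of signs gains the factor χ(B(x,y)), which sums to zero over x. Hence the signed
count is the unsigned one without its middle term (`sum_neighbours_codimInter`,
`sum_neighbours_maslov`).

Applied to k ↦ ρ^k with ρ = r^{-j}, both recurrences return a combination of ρ^k and (qρ)^k, and qρ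
= r^{-(j-2)}. So exponent j goes to exponents j and j-2. The second coefficient vanishes for j = 0
in the unsigned case and for j = 1 in the signed case, the latter because r² = q. This is
`coverGenerators_mul_mem`.

Stability of W_{2n+2} makes the Bose–Mesner space an algebra. Gram–Schmidt for the trace form,
applied to the stable flag, yields one line in each step, spanned by an idempotent that is a
polynomial of degree j in S (`exists_idempotents`). The entries of S sum to zero, so E_1 is a
multiple of S. Both signs of r are allowed, and R_1 tells the two orderings apart. -/

/-- The linear map sending `p` to the matrix obtained by applying `p` to the entries of `S`. -/
noncomputable def entrywise (S : Matrix Ω Ω ℝ) : ℝ[X] →ₗ[ℝ] Matrix Ω Ω ℝ where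
  toFun p := S.map fun t => p.eval t
  map_add' p q := by ext; simp
  map_smul' c p := by ext; simp

theorem entrywise_apply (S : Matrix Ω Ω ℝ) (p : ℝ[X]) (x y : Ω) :
    entrywise S p x y = p.eval (S x y) := rfl

/-- The span of the entrywise powers of `S` with exponent less than `m`. -/
noncomputable def powerFlag (S : Matrix Ω Ω ℝ) (m : ℕ) : Submodule ℝ (Matrix Ω Ω ℝ) :=
  (degreeLT ℝ m).map (entrywise S)

theorem entrywise_mem_powerFlag (S : Matrix Ω Ω ℝ) {m : ℕ} {p : ℝ[X]} (hp : p.degree < m) :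
    entrywise S p ∈ powerFlag S m :=
  Submodule.mem_map_of_mem (mem_degreeLT.2 hp)

theorem transpose_entrywise {S : Matrix Ω Ω ℝ} (hS : Sᵀ = S) (p : ℝ[X]) :
    (entrywise S p)ᵀ = entrywise S p := by
  ext x y
  have h : S y x = S x y := congrFun (congrFun hS x) y
  rw [transpose_apply, entrywise_apply, entrywise_apply, h]

theorem transpose_of_mem_powerFlag {S : Matrix Ω Ω ℝ} (hS : Sᵀ = S) {m : ℕ} {A : Matrix Ω Ω ℝ}
    (hA : A ∈ powerFlag S m) : Aᵀ = A := by
  obtain ⟨p, -, rfl⟩ := hA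
  exact transpose_entrywise hS p

variable [Fintype Ω]

/-- The trace form on real matrices. -/
noncomputable def matrixTraceForm (Ω : Type*) [Fintype Ω] :
    LinearMap.BilinForm ℝ (Matrix Ω Ω ℝ) :=
  LinearMap.mk₂ ℝ (fun A C => (Aᵀ * C).trace)
    (fun A A' C => by simp [Matrix.add_mul])
    (fun c A C => by simp)
    (fun A C C' => by simp [Matrix.mul_add])
    (fun c A C => by simp)

theorem matrixTraceForm_apply (A C : Matrix Ω Ω ℝ) :
    matrixTraceForm Ω A C = (Aᵀ * C).trace := rfl

theorem matrixTraceForm_isSymm : (matrixTraceForm Ω).IsSymm := by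
  refine ⟨fun A C => ?_⟩
  simp only [matrixTraceForm_apply]
  rw [← trace_transpose, transpose_mul, transpose_transpose]

theorem eq_zero_of_trace_transpose_mul_self {A : Matrix Ω Ω ℝ} (h : (Aᵀ * A).trace = 0) :
    A = 0 := by
  rw [← conjTranspose_eq_transpose_of_trivial] at h
  exact trace_conjTranspose_mul_self_eq_zero_iff.1 h

/-- The trace form is positive definite, hence nondegenerate on every subspace. -/
theorem isCompl_orthogonal_matrixTraceForm (W : Submodule ℝ (Matrix Ω Ω ℝ)) :
    IsCompl W ((matrixTraceForm Ω).orthogonal W) := by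
  apply LinearMap.BilinForm.isCompl_orthogonal_of_restrict_nondegenerate
    matrixTraceForm_isSymm.isRefl
  have hr : ((matrixTraceForm Ω).restrict W).IsRefl := fun A C h =>
    matrixTraceForm_isSymm.isRefl _ _ h
  refine (LinearMap.IsRefl.nondegenerate_iff_separatingLeft hr).2 fun A hA => ?_
  exact Subtype.ext (eq_zero_of_trace_transpose_mul_self (hA A))

/-- Orthogonalisation of the entrywise powers of `S` with respect to the trace form. -/
theorem exists_monic_orthogonal {S : Matrix Ω Ω ℝ} (hS : Sᵀ = S) (m : ℕ) :
    ∃ p : ℝ[X], p.Monic ∧ p.natDegree = m ∧ ∀ A ∈ powerFlag S m, (A * entrywise S p).trace = 0 := by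
  -- One Gram–Schmidt step: `r` will be the polynomial of the projection of the m-th power to the
  -- lower ones, and the required polynomial is `X ^ m - r`.
  have h : entrywise S (X ^ m) ∈
      powerFlag S m ⊔ (matrixTraceForm Ω).orthogonal (powerFlag S m) := by
    rw [(isCompl_orthogonal_matrixTraceForm (powerFlag S m)).sup_eq_top]
    trivial
  obtain ⟨_, ⟨r, hr, rfl⟩, C, hC, hrC⟩ := Submodule.mem_sup.1 h
  have hr' : r.degree < m := mem_degreeLT.1 hr
  refine ⟨X ^ m - r, monic_X_pow_sub hr', ?_, fun A hA => ?_⟩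
  · have : r.degree < (X ^ m : ℝ[X]).degree := by rwa [degree_X_pow]
    exact natDegree_eq_of_degree_eq_some (by rw [degree_sub_eq_left_of_degree_lt this, degree_X_pow])
  · have hE : entrywise S (X ^ m - r) = C := by rw [map_sub, ← hrC, add_sub_cancel_left]
    have h1 : matrixTraceForm Ω A C = 0 := hC A hA
    rw [matrixTraceForm_apply,
      transpose_of_mem_powerFlag hS hA] at h1
    rw [hE, h1]

/-- The product lies in the flag, whose members are all symmetric, and transposing a product of
symmetric matrices reverses it. -/
theorem commute_entrywise {S : Matrix Ω Ω ℝ} (hS : Sᵀ = S)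
    (hmul : ∀ p : ℝ[X], ∀ m, ∀ A ∈ powerFlag S m, entrywise S p * A ∈ powerFlag S m)
    (p r : ℝ[X]) :
    entrywise S p * entrywise S r = entrywise S r * entrywise S p := by
  have h := transpose_of_mem_powerFlag hS
    (hmul p (r.natDegree + 1) _ (entrywise_mem_powerFlag S (p := r)
      (lt_of_le_of_lt degree_le_natDegree (by exact_mod_cast Nat.lt_succ_self _))))
  rw [transpose_mul, transpose_entrywise hS, transpose_entrywise hS] at h
  exact h.symm

/-- The product has degree at most m, and subtracting the right multiple of `entrywise S p` leaves a
matrix L in the lower flag. Since L and, by stability and commutativity, L times `entrywise S r` are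
orthogonal to `entrywise S p`, the trace of L² is zero, so L = 0. -/
theorem exists_mul_eq_smul {S : Matrix Ω Ω ℝ} (hS : Sᵀ = S)
    (hmul : ∀ p : ℝ[X], ∀ m, ∀ A ∈ powerFlag S m, entrywise S p * A ∈ powerFlag S m)
    {m : ℕ} {p : ℝ[X]} (hp : p.Monic) (hpm : p.natDegree = m)
    (hort : ∀ A ∈ powerFlag S m, (A * entrywise S p).trace = 0) (r : ℝ[X]) :
    ∃ c : ℝ, entrywise S r * entrywise S p = c • entrywise S p := by
  have hdeg : p.degree = m := by rw [degree_eq_natDegree hp.ne_zero, hpm]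
  obtain ⟨s, hs, hse⟩ := hmul r (m + 1) _ (entrywise_mem_powerFlag S (p := p)
    (by rw [hdeg]; exact_mod_cast Nat.lt_succ_self _))
  refine ⟨s.coeff m, ?_⟩
  have hlow : entrywise S (s - C (s.coeff m) * p) ∈ powerFlag S m := by
    apply entrywise_mem_powerFlag
    rw [degree_lt_iff_coeff_zero]
    intro k hk
    rcases hk.eq_or_lt with rfl | hk
    · have : p.coeff m = 1 := by rw [← hpm]; exact hp
      rw [coeff_sub, coeff_C_mul, this, mul_one, sub_self]
    · have h1 : s.coeff k = 0 :=
        coeff_eq_zero_of_degree_lt (lt_of_lt_of_le (mem_degreeLT.1 hs) (by exact_mod_cast hk))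
      have h2 : p.coeff k = 0 := coeff_eq_zero_of_natDegree_lt (by rw [hpm]; exact hk)
      rw [coeff_sub, coeff_C_mul, h1, h2, mul_zero, sub_zero]
  have heq : entrywise S (s - C (s.coeff m) * p) =
      entrywise S r * entrywise S p - s.coeff m • entrywise S p := by
    rw [map_sub, hse, ← smul_eq_C_mul, map_smul]
  rw [← sub_eq_zero, ← heq]
  apply eq_zero_of_trace_transpose_mul_self
  rw [transpose_entrywise hS]
  nth_rewrite 2 [heq]
  rw [Matrix.mul_sub, trace_sub, Matrix.mul_smul, trace_smul, hort _ hlow, smul_zero, sub_zero,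
    ← Matrix.mul_assoc, commute_entrywise hS hmul _ r]
  exact hort _ (hmul _ _ _ hlow)

open scoped Classical in
/-- If the spans of the entrywise powers of a symmetric matrix `S` with `d + 1` values are ideals,
then orthogonalising these powers yields a complete system of orthogonal idempotents. -/
theorem exists_idempotents {S : Matrix Ω Ω ℝ} (hS : Sᵀ = S)
    (hmul : ∀ p : ℝ[X], ∀ m, ∀ A ∈ powerFlag S m, entrywise S p * A ∈ powerFlag S m)
    {θ : Fin (d + 1) → ℝ} (hθ : Function.Injective θ) (hval : ∀ i, ∃ x y, S x y = θ i)
    (hone : (1 : Matrix Ω Ω ℝ) ∈ powerFlag S (d + 1)) :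
    ∃ p : ℕ → ℝ[X], (∀ j, (p j).natDegree = j) ∧ (∀ j ≤ d, p j ≠ 0) ∧
      (∀ j ≤ d, entrywise S (p j) ≠ 0) ∧
      (∀ j ≤ d, entrywise S (p j) * entrywise S (p j) = entrywise S (p j)) ∧
      (∀ i ≤ d, ∀ j ≤ d, i ≠ j → entrywise S (p i) * entrywise S (p j) = 0) ∧
      ∑ j : Fin (d + 1), entrywise S (p j) = 1 ∧
      ∀ j, ∀ A ∈ powerFlag S j, (A * entrywise S (p j)).trace = 0 := by
  choose u hu hdeg hort using exists_monic_orthogonal hS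
  -- A nonzero polynomial of degree at most d cannot vanish at the d + 1 values of S.
  have hu0 : ∀ j ≤ d, entrywise S (u j) ≠ 0 := by
    intro j hj h0
    have hroot : ∀ i, (u j).eval (θ i) = 0 := by
      intro i
      obtain ⟨x, y, hxy⟩ := hval i
      rw [← hxy, ← entrywise_apply, h0]
      rfl
    have hcard : (Finset.univ.image θ).card = d + 1 := by
      rw [Finset.card_image_of_injective _ hθ, Finset.card_univ, Fintype.card_fin]
    apply (hu j).ne_zero
    refine eq_zero_of_natDegree_lt_card_of_eval_eq_zero' (u j) (Finset.univ.image θ) ?_ ?_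
    · intro t ht
      obtain ⟨i, -, rfl⟩ := Finset.mem_image.1 ht
      exact hroot i
    · rw [hdeg, hcard]
      omega
  have hsmul : ∀ j r, ∃ c : ℝ, entrywise S r * entrywise S (u j) = c • entrywise S (u j) :=
    fun j r => exists_mul_eq_smul hS hmul (hu j) (hdeg j) (hort j) r
  choose c hc using fun j => hsmul j (u j)
  have htr : ∀ j ≤ d, (entrywise S (u j) * entrywise S (u j)).trace ≠ 0 := by
    intro j hj h0
    apply hu0 j hj
    apply eq_zero_of_trace_transpose_mul_self
    rwa [transpose_entrywise hS]
  have hc0 : ∀ j ≤ d, c j ≠ 0 := by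
    intro j hj h0
    apply htr j hj
    rw [hc, h0, zero_smul, trace_zero]
  have hmem : ∀ i j, i < j → entrywise S (u i) ∈ powerFlag S j := by
    intro i j hij
    apply entrywise_mem_powerFlag
    rw [degree_eq_natDegree (hu i).ne_zero, hdeg]
    exact_mod_cast hij
  have horth : ∀ i ≤ d, ∀ j ≤ d, i ≠ j → entrywise S (u i) * entrywise S (u j) = 0 := by
    -- The product is both a multiple a of the j-th matrix and a multiple b of the i-th. Multiplying
    -- by the j-th and taking traces kills the b side, so a = 0.
    have key : ∀ i j, j ≤ d → i < j → entrywise S (u i) * entrywise S (u j) = 0 := by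
      intro i j hj hij
      obtain ⟨a, ha⟩ := hsmul j (u i)
      obtain ⟨b, hb⟩ := hsmul i (u j)
      rw [commute_entrywise hS hmul, ha] at hb
      have h1 : a * (entrywise S (u j) * entrywise S (u j)).trace = 0 := by
        have h2 := congrArg (fun A => (A * entrywise S (u j)).trace) hb
        simp only [Matrix.smul_mul, trace_smul, smul_eq_mul] at h2
        rw [h2, hort j _ (hmem i j hij), mul_zero]
      rw [ha, (mul_eq_zero.1 h1).resolve_right (htr j hj), zero_smul]
    intro i hi j hj hij
    rcases lt_or_gt_of_ne hij with h | h
    · exact key i j hj h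
    · rw [commute_entrywise hS hmul]
      exact key j i hi h
  -- The square of the j-th matrix is `c j` times itself, so dividing by `c j` gives an idempotent.
  -- Beyond d the matrix may vanish, and `u j` is kept as it is.
  set p : ℕ → ℝ[X] := fun j => if j ≤ d then (c j)⁻¹ • u j else u j with hp
  have hpj : ∀ j ≤ d, entrywise S (p j) = (c j)⁻¹ • entrywise S (u j) := by
    intro j hj
    simp only [hp, if_pos hj, map_smul]
  have hpu : ∀ j ≤ d, entrywise S (p j) * entrywise S (u j) = entrywise S (u j) := by
    intro j hj
    rw [hpj j hj, Matrix.smul_mul, hc, smul_smul, inv_mul_cancel₀ (hc0 j hj), one_smul]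
  -- The sum of the idempotents fixes every member of the flag; applied to the identity matrix, this
  -- shows that the sum is the identity.
  have hfix : ∀ k ≤ d + 1, ∀ A ∈ powerFlag S k,
      (∑ j : Fin (d + 1), entrywise S (p j)) * A = A := by
    intro k
    induction k with
    | zero =>
      rintro - _ ⟨r, hr, rfl⟩
      have : r = 0 := by
        rw [← degree_eq_bot, ← Nat.WithBot.lt_zero_iff]
        exact mem_degreeLT.1 hr
      rw [this, map_zero, Matrix.mul_zero]
    | succ k ih =>
      rintro hk _ ⟨r, hr, rfl⟩
      have hk' : k ≤ d := by omega
      have hlow : (r - C (r.coeff k) * u k).degree < k := by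
        rw [degree_lt_iff_coeff_zero]
        intro l hl
        rcases hl.eq_or_lt with rfl | hl
        · have : (u k).coeff k = 1 := by
            have := hu k
            rwa [Monic, leadingCoeff, hdeg] at this
          rw [coeff_sub, coeff_C_mul, this, mul_one, sub_self]
        · have h1 : r.coeff l = 0 :=
            coeff_eq_zero_of_degree_lt (lt_of_lt_of_le (mem_degreeLT.1 hr) (by exact_mod_cast hl))
          have h2 : (u k).coeff l = 0 :=
            coeff_eq_zero_of_natDegree_lt (by rw [hdeg]; exact hl)
          rw [coeff_sub, coeff_C_mul, h1, h2, mul_zero, sub_zero]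
      have h1 := ih (by omega) _ (entrywise_mem_powerFlag S hlow)
      have h2 : (∑ j : Fin (d + 1), entrywise S (p j)) * entrywise S (u k) = entrywise S (u k) := by
        rw [Finset.sum_mul, Finset.sum_eq_single (⟨k, by omega⟩ : Fin (d + 1))]
        · exact hpu k hk'
        · intro j _ hj
          have hj' : (j : ℕ) ≤ d := by omega
          rw [hpj _ hj', Matrix.smul_mul, horth _ hj' _ hk', smul_zero]
          intro h
          exact hj (Fin.ext h)
        · simp
      rw [map_sub, ← smul_eq_C_mul, map_smul, Matrix.mul_sub, Matrix.mul_smul, h2] at h1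
      exact sub_left_injective h1
  refine ⟨p, ?_, ?_, ?_, ?_, ?_, ?_, ?_⟩
  · intro j
    by_cases hj : j ≤ d
    · simp only [hp, if_pos hj]
      rw [natDegree_smul _ (inv_ne_zero (hc0 j hj)), hdeg]
    · simp only [hp, if_neg hj, hdeg]
  · intro j hj
    simp only [hp, if_pos hj]
    exact smul_ne_zero (inv_ne_zero (hc0 j hj)) (hu j).ne_zero
  · intro j hj
    rw [hpj j hj]
    exact smul_ne_zero (inv_ne_zero (hc0 j hj)) (hu0 j hj)
  · intro j hj
    nth_rewrite 2 [hpj j hj]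
    rw [Matrix.mul_smul, hpu j hj, ← hpj j hj]
  · intro i hi j hj hij
    rw [hpj i hi, hpj j hj, Matrix.smul_mul, Matrix.mul_smul, horth i hi j hj hij, smul_zero,
      smul_zero]
  · have := hfix (d + 1) le_rfl 1 hone
    rwa [Matrix.mul_one] at this
  · intro j A hA
    by_cases hj : j ≤ d
    · rw [hpj j hj, Matrix.mul_smul, trace_smul, hort j A hA, smul_zero]
    · simp only [hp, if_neg hj, hort j A hA]

end FlagOfIdeals

/-! ### From a stable flag to a Q-polynomial scheme -/

section SchemeFromFlag

open Polynomial Matrix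

variable {Ω : Type*} {d : ℕ} {R : Fin (d + 1) → Ω → Ω → Prop} {S : Matrix Ω Ω ℝ}
  {θ : Fin (d + 1) → ℝ}

theorem adjacencyMatrix_apply_of_rel (hpart : ∀ x y, ∃! i, R i x y) {k : Fin (d + 1)} {x y : Ω}
    (h : R k x y) (i : Fin (d + 1)) : adjacencyMatrix R i x y = if i = k then 1 else 0 := by
  unfold adjacencyMatrix
  rw [of_apply]
  congr 1
  exact propext ⟨fun hi => (hpart x y).unique hi h, fun hi => hi ▸ h⟩

theorem eq_of_mem_boseMesner (hpart : ∀ x y, ∃! i, R i x y) {A : Matrix Ω Ω ℝ}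
    (hA : A ∈ boseMesner R) {k : Fin (d + 1)} {x y x' y' : Ω} (h : R k x y) (h' : R k x' y') :
    A x y = A x' y' := by
  induction hA using Submodule.span_induction with
  | mem A hA =>
    obtain ⟨i, rfl⟩ := hA
    rw [adjacencyMatrix_apply_of_rel hpart h, adjacencyMatrix_apply_of_rel hpart h']
  | zero => rfl
  | add A C _ _ hA hC => rw [Matrix.add_apply, Matrix.add_apply, hA, hC]
  | smul c A _ hA => rw [Matrix.smul_apply, Matrix.smul_apply, hA]

theorem entrywise_mem_boseMesner (hpart : ∀ x y, ∃! i, R i x y)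
    (hS : ∀ i x y, R i x y → S x y = θ i) (p : ℝ[X]) : entrywise S p ∈ boseMesner R := by
  have : entrywise S p = ∑ i, p.eval (θ i) • adjacencyMatrix R i := by
    ext x y
    obtain ⟨k, hk, -⟩ := hpart x y
    rw [entrywise_apply, hS k x y hk, Matrix.sum_apply]
    simp only [Matrix.smul_apply, adjacencyMatrix_apply_of_rel hpart hk, smul_eq_mul, mul_ite, mul_one,
      mul_zero, Finset.sum_ite_eq', Finset.mem_univ, if_true]
  rw [this]
  exact Submodule.sum_mem _ fun i _ => Submodule.smul_mem _ _ (Submodule.subset_span ⟨i, rfl⟩)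

/-- Lagrange interpolation at the distinct values of S: the i-th basis polynomial takes S to the
i-th adjacency matrix. -/
theorem boseMesner_le_powerFlag (hpart : ∀ x y, ∃! i, R i x y)
    (hS : ∀ i x y, R i x y → S x y = θ i) (hθ : Function.Injective θ) :
    boseMesner R ≤ powerFlag S (d + 1) := by
  refine Submodule.span_le.2 ?_
  rintro _ ⟨i, rfl⟩
  have hinj : Set.InjOn θ (Finset.univ : Finset (Fin (d + 1))) := hθ.injOn
  have : adjacencyMatrix R i = entrywise S (Lagrange.basis Finset.univ θ i) := by
    ext x y
    obtain ⟨k, hk, -⟩ := hpart x y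
    rw [entrywise_apply, hS k x y hk, adjacencyMatrix_apply_of_rel hpart hk]
    split_ifs with h
    · rw [h, Lagrange.eval_basis_self (by rwa [h] at *) (Finset.mem_univ _)]
    · rw [Lagrange.eval_basis_of_ne h (Finset.mem_univ _)]
  rw [this]
  apply entrywise_mem_powerFlag
  rw [Lagrange.degree_basis hinj (Finset.mem_univ _), Finset.card_univ, Fintype.card_fin]
  exact_mod_cast Nat.lt_succ_self _

theorem powerFlag_le_boseMesner (hpart : ∀ x y, ∃! i, R i x y)
    (hS : ∀ i x y, R i x y → S x y = θ i) (m : ℕ) : powerFlag S m ≤ boseMesner R := by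
  rintro _ ⟨p, -, rfl⟩
  exact entrywise_mem_boseMesner hpart hS p

theorem transpose_eq_of_rel (hpart : ∀ x y, ∃! i, R i x y) (hsymm : ∀ i x y, R i x y → R i y x)
    (hS : ∀ i x y, R i x y → S x y = θ i) : Sᵀ = S := by
  ext x y
  obtain ⟨k, hk, -⟩ := hpart x y
  rw [transpose_apply, hS k x y hk, hS k y x (hsymm k x y hk)]

/-- The intersection numbers are the entries of products of adjacency matrices, and members of the
Bose–Mesner space are constant on each relation. -/
theorem isAssociationScheme_of_mul_mem [Fintype Ω] (hpart : ∀ x y, ∃! i, R i x y)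
    (hne : ∀ i, ∃ x y, R i x y) (hid : ∀ x y, R 0 x y ↔ x = y)
    (hsymm : ∀ i x y, R i x y → R i y x)
    (hmul : ∀ A ∈ boseMesner R, ∀ C ∈ boseMesner R, A * C ∈ boseMesner R) :
    IsAssociationScheme R where
  finite := inferInstance
  nonempty := hne
  partition := hpart
  identity := hid
  symmetric := hsymm
  intersection i j k := by
    classical
    obtain ⟨x₀, y₀, h₀⟩ := hne k
    refine ⟨{z | R i x₀ z ∧ R j z y₀}.ncard, fun x y h => ?_⟩
    have hcount : ∀ x y, (adjacencyMatrix R i * adjacencyMatrix R j) x y =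
        ({z | R i x z ∧ R j z y}.ncard : ℝ) := by
      intro x y
      rw [Set.ncard_eq_toFinset_card', mul_apply]
      simp only [adjacencyMatrix, of_apply, mul_ite, mul_one, mul_zero, ← ite_and]
      rw [Finset.sum_boole]
      congr 2
      ext z
      simp [and_comm]
    have := eq_of_mem_boseMesner hpart (hmul _ (Submodule.subset_span ⟨i, rfl⟩) _
      (Submodule.subset_span ⟨j, rfl⟩)) h h₀
    rw [hcount, hcount] at this
    exact_mod_cast this

theorem exists_isQPolynomialOrdering [Fintype Ω] (hd : 1 ≤ d) (hpart : ∀ x y, ∃! i, R i x y)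
    (hne : ∀ i, ∃ x y, R i x y) (hid : ∀ x y, R 0 x y ↔ x = y)
    (hsymm : ∀ i x y, R i x y → R i y x) (hS : ∀ i x y, R i x y → S x y = θ i)
    (hθ : Function.Injective θ) (hθ0 : θ 0 = 1) (hsum : ∑ x, ∑ y, S x y = 0)
    (hmul : ∀ A ∈ boseMesner R, ∀ m, ∀ C ∈ powerFlag S m, A * C ∈ powerFlag S m) :
    ∃ E, IsQPolynomialOrdering R E ∧
      ∀ k a b, R k a b → E 1 a b = E 1 a a * θ k := by
  classical
  have hST := transpose_eq_of_rel hpart hsymm hS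
  have hone : (1 : Matrix Ω Ω ℝ) ∈ powerFlag S (d + 1) := by
    apply boseMesner_le_powerFlag hpart hS hθ
    have : (1 : Matrix Ω Ω ℝ) = adjacencyMatrix R 0 := by
      ext x y
      simp [adjacencyMatrix, one_apply, hid]
    rw [this]
    exact Submodule.subset_span ⟨0, rfl⟩
  obtain ⟨p, hdeg, hp0, hE0, hidem, horth, hsum1, htr⟩ := exists_idempotents hST
    (fun p => hmul _ (entrywise_mem_boseMesner hpart hS p)) hθ
    (fun i => by
      obtain ⟨x, y, h⟩ := hne i
      exact ⟨x, y, hS i x y h⟩) hone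
  have hle : ∀ j : Fin (d + 1), (j : ℕ) ≤ d := fun j => Nat.lt_succ_iff.1 j.2
  have h1 : ((1 : Fin (d + 1)) : ℕ) = 1 := by
    rw [Fin.val_one', Nat.mod_eq_of_lt (by omega)]
  have hp1 : p 1 = C ((p 1).coeff 1) * X := by
    have hX := eq_X_add_C_of_natDegree_le_one (hdeg 1).le
    have hJ : entrywise S 1 ∈ powerFlag S 1 := entrywise_mem_powerFlag S (by simp)
    have ht := htr 1 _ hJ
    -- The zeroth entrywise power is the all-ones matrix, so this trace is the sum of all entries.
    -- The linear term drops out by `hsum`; orthogonality then removes the constant coefficient of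
    -- `p 1`.
    have hv : (entrywise S 1 * entrywise S (p 1)).trace =
        (p 1).coeff 0 * (Fintype.card Ω : ℝ) ^ 2 := by
      rw [hX, trace]
      simp only [diag_apply, mul_apply, entrywise_apply, eval_one, one_mul, eval_add, eval_mul,
        eval_C, eval_X, Finset.sum_add_distrib, ← Finset.mul_sum, Finset.sum_const]
      have hsum' : ∑ x, ∑ y, S y x = 0 := by rw [Finset.sum_comm]; exact hsum
      rw [hsum']
      simp
      ring
    have hΩ : (Fintype.card Ω : ℝ) ≠ 0 := by
      obtain ⟨x, -, -⟩ := hne 0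
      have : Nonempty Ω := ⟨x⟩
      exact_mod_cast Fintype.card_ne_zero
    rw [hv] at ht
    have h0 := (mul_eq_zero.1 ht).resolve_right (pow_ne_zero 2 hΩ)
    rw [h0, C_0, add_zero] at hX
    exact hX
  set c := (p 1).coeff 1 with hc
  have hc0 : c ≠ 0 := by
    intro h0
    apply hp0 1 hd
    rw [hp1, h0, C_0, zero_mul]
  have hE1 : ∀ x y, entrywise S (p 1) x y = c * S x y := by
    intro x y
    rw [entrywise_apply, hp1, eval_mul, eval_C, eval_X]
  refine ⟨fun j => entrywise S (p j), ⟨⟨fun j => entrywise_mem_boseMesner hpart hS _,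
    fun j => hE0 j (hle j), fun j => hidem j (hle j), fun i j hij => horth i (hle i) j (hle j)
      fun h => hij (Fin.ext h), ?_⟩, fun j => ?_⟩, fun k a b hk => ?_⟩
  · convert hsum1
  -- The j-th idempotent is a polynomial in S; it becomes one in E_1 = c S after rescaling the
  -- variable.
  · refine ⟨(p j).comp (C c⁻¹ * X), ?_, ?_⟩
    · have hl : (C c⁻¹ * X : ℝ[X]).natDegree = 1 := natDegree_C_mul_X _ (inv_ne_zero hc0)
      have hn : ((p j).comp (C c⁻¹ * X)).natDegree = j := by
        rw [natDegree_comp, hl, hdeg, mul_one]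
      rw [degree_eq_natDegree, hn]
      intro h0
      rw [comp_eq_zero_iff] at h0
      rcases h0 with h0 | ⟨-, h0⟩
      · exact hp0 j (hle j) h0
      · have := congrArg natDegree h0
        rw [hl, natDegree_C] at this
        exact one_ne_zero this
    · ext x y
      change entrywise S (p j) x y = eval (entrywise S (p (1 : Fin (d + 1))) x y) _
      rw [h1, hE1, entrywise_apply, eval_comp, eval_mul, eval_C, eval_X,
        inv_mul_cancel_left₀ hc0]
  · simp only [h1]
    rw [hE1, hE1, hS k a b hk, hS 0 a a ((hid a a).2 rfl), hθ0, mul_one]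

/-- The matrices whose left multiplication preserves a subspace. -/
noncomputable def stabilizerSubalgebra [Fintype Ω] [DecidableEq Ω]
    (W : Submodule ℝ (Matrix Ω Ω ℝ)) : Subalgebra ℝ (Matrix Ω Ω ℝ) where
  carrier := {A | ∀ C ∈ W, A * C ∈ W}
  mul_mem' {A A'} hA hA' C hC := by
    rw [Matrix.mul_assoc]
    exact hA _ (hA' _ hC)
  add_mem' {A A'} hA hA' C hC := by
    rw [Matrix.add_mul]
    exact W.add_mem (hA _ hC) (hA' _ hC)
  algebraMap_mem' c C hC := by
    rw [Algebra.algebraMap_eq_smul_one, Matrix.smul_mul, Matrix.one_mul]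
    exact W.smul_mem c hC

/-- Stability of a subspace under an algebra need only be checked on generators. -/
theorem adjoin_mul_mem [Fintype Ω] [DecidableEq Ω] {W : Submodule ℝ (Matrix Ω Ω ℝ)}
    {G : Set (Matrix Ω Ω ℝ)} (hG : ∀ A ∈ G, ∀ C ∈ W, A * C ∈ W) {A C : Matrix Ω Ω ℝ}
    (hA : A ∈ Algebra.adjoin ℝ G) (hC : C ∈ W) : A * C ∈ W :=
  (Algebra.adjoin_le hG : Algebra.adjoin ℝ G ≤ stabilizerSubalgebra W) hA C hC

end SchemeFromFlag

/-! ### The Maslov index from arbitrary dual families -/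

section MaslovIndex

open Matrix

variable {F V : Type*} [Field F] [AddCommGroup V] [Module F V] {B : LinearMap.BilinForm F V}

namespace Generator

theorem isotropic (X : Generator B) {x y : V} (hx : x ∈ X.1) (hy : y ∈ X.1) : B x y = 0 := by
  rw [← X.2] at hy
  exact hy x hx

theorem mem_of_forall (X : Generator B) {y : V} (h : ∀ x ∈ X.1, B x y = 0) : y ∈ X.1 := by
  rw [← X.2]
  exact h

theorem eq_of_le {X Y : Generator B} (h : X.1 ≤ Y.1) : X = Y :=
  Subtype.ext (le_antisymm h fun _ hy => X.mem_of_forall fun _ hx => Y.isotropic (h hx) hy)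

theorem finrank_eq [FiniteDimensional F V] {n : ℕ} (hV : Module.finrank F V = 2 * n)
    (hB' : B.Nondegenerate) (X : Generator B) : Module.finrank F X.1 = n := by
  have h := LinearMap.BilinForm.finrank_orthogonal hB' X.1
  rw [X.2, hV] at h
  have h2 := Submodule.finrank_le X.1
  omega

end Generator

variable {n : ℕ} {X Y : Generator B} (δ : (X : Generator B) → X.1 [⋀^Fin n]→ₗ[F] F)

theorem repr_eq_zero_of_mem_span {x : Module.Basis (Fin n) F X.1} {p : Fin n → Prop} {v : X.1}
    (hv : (v : V) ∈ Submodule.span F {w : V | ∃ i, p i ∧ (x i : V) = w}) {i : Fin n}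
    (hi : ¬ p i) : x.repr v i = 0 := by
  have hle : Submodule.span F {w : V | ∃ i, p i ∧ (x i : V) = w} ≤
      (LinearMap.ker (x.coord i)).map X.1.subtype := by
    rw [Submodule.span_le]
    rintro _ ⟨j, hj, rfl⟩
    refine ⟨x j, ?_, rfl⟩
    rw [SetLike.mem_coe, LinearMap.mem_ker, Module.Basis.coord_apply, Module.Basis.repr_self,
      Finsupp.single_eq_of_ne]
    rintro rfl
    exact hi hj
  obtain ⟨w, hw, hwv⟩ := hle hv
  rw [← Subtype.ext hwv]
  exact hw

theorem det_map_eq (X : Generator B) (x x' : Module.Basis (Fin n) F X.1) :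
    δ X x' = (x.toMatrix x').det * δ X x := by
  nth_rewrite 1 [(δ X).eq_smul_basis_det x]
  rw [AlternatingMap.smul_apply, Module.Basis.det_apply, smul_eq_mul, mul_comm]

/-- For two adapted pairs of bases, the values differ by a nonzero square. -/
theorem exists_maslovValue_eq_sq_mul {x x' : Module.Basis (Fin n) F X.1}
    {y y' : Module.Basis (Fin n) F Y.1} (h : IsAdapted x y) (h' : IsAdapted x' y') :
    ∃ c : F, c ≠ 0 ∧ maslovValue δ x' y' = c ^ 2 * maslovValue δ x y := by
  set k := codimInter X Y with hk
  set P := x.toMatrix x' with hP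
  set Q := y.toMatrix y' with hQ
  have hmem : ∀ j : Fin n, k ≤ j → (x' j : V) ∈ Submodule.span F
      {v : V | ∃ i : Fin n, k ≤ (i : ℕ) ∧ (x i : V) = v} := by
    intro j hj
    rw [h.2, ← h'.2]
    exact Submodule.subset_span ⟨j, hj, rfl⟩
  have hXY : ∀ i : Fin n, k ≤ i → (x i : V) ∈ X.1 ⊓ Y.1 := by
    intro i hi
    rw [← h.2]
    exact Submodule.subset_span ⟨i, hi, rfl⟩
  -- The last n - k vectors of each basis of X span X ∩ Y, so the transition matrix is block
  -- triangular.
  have hP0 : ∀ i j : Fin n, (i : ℕ) < k → k ≤ (j : ℕ) → P i j = 0 := fun i j hi hj =>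
    repr_eq_zero_of_mem_span (p := fun i => k ≤ (i : ℕ)) (hmem j hj) (not_le.2 hi)
  -- The bases of X and Y share their part in X ∩ Y, so the transition matrices share the
  -- corresponding columns.
  have hPQ : ∀ i j : Fin n, k ≤ (j : ℕ) → Q i j = P i j := by
    intro i j hj
    have hy : y' j = ∑ a, P a j • y a := by
      apply Subtype.ext
      rw [← h'.1 j hj]
      have h1 : (x' j : V) = ∑ a, P a j • (x a : V) := by
        conv_lhs => rw [← x.sum_repr (x' j)]
        simp only [Submodule.coe_sum, Submodule.coe_smul]
        rfl
      rw [h1, Submodule.coe_sum]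
      refine Finset.sum_congr rfl fun a _ => ?_
      rw [Submodule.coe_smul]
      rcases lt_or_ge (a : ℕ) k with ha | ha
      · rw [hP0 a j ha hj, zero_smul, zero_smul]
      · rw [h.1 a ha]
    change y.repr (y' j) i = _
    rw [hy, y.repr_sum_self]
  have hdP : P.det = (P.toSquareBlockProp fun i => (i : ℕ) < k).det *
      (P.toSquareBlockProp fun i => ¬ (i : ℕ) < k).det := by
    rw [← det_transpose, twoBlockTriangular_det Pᵀ (fun i => (i : ℕ) < k)
      (fun i hi j hj => hP0 j i hj (not_lt.1 hi))]
    congr 1 <;> rw [← det_transpose] <;> rfl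
  have hdQ : Q.det = (Q.toSquareBlockProp fun i => (i : ℕ) < k).det *
      (P.toSquareBlockProp fun i => ¬ (i : ℕ) < k).det := by
    rw [← det_transpose, twoBlockTriangular_det Qᵀ (fun i => (i : ℕ) < k)
      (fun i hi j hj => (hPQ j i (not_lt.1 hi)).trans (hP0 j i hj (not_lt.1 hi)))]
    congr 1
    · rw [← det_transpose]
      rfl
    · rw [← det_transpose]
      congr 1
      ext i j
      exact hPQ i.1 j.1 (not_lt.1 j.2)
  set P₁ := P.toSquareBlockProp fun i => (i : ℕ) < k with hP₁
  set Q₁ := Q.toSquareBlockProp fun i => (i : ℕ) < k with hQ₁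
  have hgram : (Matrix.of fun i j : {i : Fin n // (i : ℕ) < k} => B (x' i.1 : V) (y' j.1 : V)) =
      P₁ᵀ * (Matrix.of fun i j : {i : Fin n // (i : ℕ) < k} => B (x i.1 : V) (y j.1 : V)) * Q₁ := by
    have hdrop : ∀ f : Fin n → F, (∀ i : Fin n, k ≤ (i : ℕ) → f i = 0) →
        ∑ i, f i = ∑ i : {i : Fin n // (i : ℕ) < k}, f i := by
      intro f hf
      rw [← Finset.sum_subtype (Finset.univ.filter fun i : Fin n => (i : ℕ) < k) (by simp) f,
        Finset.sum_filter]
      refine Finset.sum_congr rfl fun i _ => ?_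
      split_ifs with hi
      · rfl
      · exact hf i (not_lt.1 hi)
    ext i j
    have h1 : (x' i : V) = ∑ a, P a i • (x a : V) := by
      conv_lhs => rw [← x.sum_repr (x' i)]
      simp only [Submodule.coe_sum, Submodule.coe_smul]
      rfl
    have h2 : (y' j : V) = ∑ a, Q a j • (y a : V) := by
      conv_lhs => rw [← y.sum_repr (y' j)]
      simp only [Submodule.coe_sum, Submodule.coe_smul]
      rfl
    have h3 : B (x' i : V) (y' j : V) = ∑ a, P a i * B (x a) (y' j) := by
      rw [h1]
      simp only [map_sum, map_smul, LinearMap.sum_apply, LinearMap.smul_apply, smul_eq_mul]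
    have h4 : ∀ a, B (x a : V) (y' j : V) = ∑ b, Q b j * B (x a) (y b) := by
      intro a
      rw [h2]
      simp only [map_sum, map_smul, smul_eq_mul]
    rw [of_apply, h3, hdrop, Matrix.mul_assoc, mul_apply]
    · refine Finset.sum_congr rfl fun a _ => ?_
      rw [h4, hdrop, mul_apply]
      · congr 1
        refine Finset.sum_congr rfl fun b _ => ?_
        rw [mul_comm]
        rfl
      · intro b hb
        have : (y b : V) ∈ X.1 := by
          rw [← h.1 b hb]
          exact (x b).2
        rw [X.isotropic (x a).2 this, mul_zero]
    · intro a ha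
      rw [Y.isotropic (hXY a ha).2 (y' j).2, mul_zero]
  -- The two forms δ contribute det P · det Q = det P₁ · det Q₁ · (common block)², and the Gram
  -- determinant contributes det P₁ · det Q₁ once more.
  refine ⟨P₁.det * Q₁.det * (P.toSquareBlockProp fun i => ¬ (i : ℕ) < k).det, ?_, ?_⟩
  · have hPu : P.det ≠ 0 := by
      have := x.isUnit_det x'
      rw [Module.Basis.det_apply] at this
      exact this.ne_zero
    have hQu : Q.det ≠ 0 := by
      have := y.isUnit_det y'
      rw [Module.Basis.det_apply] at this
      exact this.ne_zero
    rw [hdP] at hPu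
    rw [hdQ] at hQu
    exact mul_ne_zero (mul_ne_zero (left_ne_zero_of_mul hPu) (left_ne_zero_of_mul hQu))
      (right_ne_zero_of_mul hPu)
  · unfold maslovValue
    rw [← hk, hgram, det_map_eq δ X x x', det_map_eq δ Y y y', ← hP, ← hQ, hdP, hdQ, det_mul,
      det_mul, det_transpose]
    ring

theorem linearIndependent_of_map_ne_zero {x : Fin n → X.1} (h : δ X x ≠ 0) :
    LinearIndependent F x := by
  by_contra hx
  exact h ((δ X).map_linearDependent x hx)

theorem map_ne_zero_of_linearIndependent [FiniteDimensional F V] (hX : Module.finrank F X.1 = n)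
    (hδ : δ X ≠ 0) {x : Fin n → X.1} (h : LinearIndependent F x) : δ X x ≠ 0 := by
  have hs := h.span_eq_top_of_card_eq_finrank' (by rw [Fintype.card_fin, hX])
  have := ((δ X).map_basis_ne_zero_iff (Module.Basis.mk h hs.ge)).2 hδ
  rwa [Module.Basis.coe_mk] at this

/-- The Maslov index computed from any pair of families which agree off a set `s` of indices and
are in perfect duality on `s`. -/
theorem codimInter_eq_and_maslov_eq [FiniteDimensional F V] [Fintype F] [DecidableEq F]
    (hX : Module.finrank F X.1 = n) (hY : Module.finrank F Y.1 = n)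
    (x : Fin n → X.1) (y : Fin n → Y.1) (s : Finset (Fin n))
    (hxy : ∀ i ∉ s, (x i : V) = (y i : V)) {c : F}
    (hc : c = δ X x * δ Y y * (Matrix.of fun i j : s => B (x i : V) (y j : V)).det)
    (hc0 : c ≠ 0) :
    codimInter X Y = s.card ∧ ((maslov δ X Y : ℤˣ) : ℤ) = quadraticChar F c := by
  have hδX : δ X x ≠ 0 := by
    rintro h
    apply hc0
    rw [hc, h, zero_mul, zero_mul]
  have hδY : δ Y y ≠ 0 := by
    rintro h
    apply hc0
    rw [hc, h, mul_zero, zero_mul]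
  have hdet : (Matrix.of fun i j : s => B (x i : V) (y j : V)).det ≠ 0 := by
    rintro h
    apply hc0
    rw [hc, h, mul_zero]
  have hix := linearIndependent_of_map_ne_zero δ hδX
  have hiy := linearIndependent_of_map_ne_zero δ hδY
  have hsx := hix.span_eq_top_of_card_eq_finrank' (by rw [Fintype.card_fin, hX])
  have hsy := hiy.span_eq_top_of_card_eq_finrank' (by rw [Fintype.card_fin, hY])
  set bx := Module.Basis.mk hix hsx.ge with hbx
  set bY := Module.Basis.mk hiy hsy.ge with hby
  have hcx : ⇑bx = x := Module.Basis.coe_mk _ _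
  have hcy : ⇑bY = y := Module.Basis.coe_mk _ _
  have hspan : Submodule.span F {v : V | ∃ i, i ∉ s ∧ (x i : V) = v} = X.1 ⊓ Y.1 := by
    apply le_antisymm
    · rw [Submodule.span_le]
      rintro _ ⟨i, hi, rfl⟩
      refine ⟨(x i).2, ?_⟩
      rw [hxy i hi]
      exact (y i).2
    · rintro v ⟨hvX, hvY⟩
      have hv : v = ∑ i, bx.repr ⟨v, hvX⟩ i • (x i : V) := by
        have := congrArg Subtype.val (bx.sum_repr ⟨v, hvX⟩)
        rw [Submodule.coe_sum] at this
        simpa only [Submodule.coe_smul, hcx] using this.symm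
      set a := bx.repr ⟨v, hvX⟩ with ha
      -- A vector of X ∩ Y is orthogonal to Y, so its coordinates on `s` lie in the left kernel of
      -- the nonsingular Gram matrix.
      have hz : ∀ i ∈ s, a i = 0 := by
        have hvm : (fun i : s => a i) ᵥ* (Matrix.of fun i j : s => B (x i : V) (y j : V)) = 0 := by
          ext j
          have h0 : B v (y j : V) = 0 := Y.isotropic hvY (y j).2
          rw [hv] at h0
          simp only [map_sum, map_smul, LinearMap.sum_apply, LinearMap.smul_apply,
            smul_eq_mul] at h0
          rw [vecMul, dotProduct, Pi.zero_apply, ← h0]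
          refine (Finset.sum_coe_sort s fun i => a i * B (x i : V) (y j : V)).trans ?_
          apply Finset.sum_subset (Finset.subset_univ _)
          intro i _ hi
          rw [hxy i hi, Y.isotropic (y i).2 (y j).2, mul_zero]
        have := eq_zero_of_vecMul_eq_zero hdet hvm
        intro i hi
        exact congrFun this ⟨i, hi⟩
      rw [hv]
      refine Submodule.sum_mem _ fun i _ => ?_
      by_cases hi : i ∈ s
      · rw [hz i hi, zero_smul]
        exact Submodule.zero_mem _
      · exact Submodule.smul_mem _ _ (Submodule.subset_span ⟨i, hi, rfl⟩)
  have hcodim : codimInter X Y = s.card := by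
    have h1 : {v : V | ∃ i, i ∉ s ∧ (x i : V) = v} =
        Set.range fun i : {i // i ∉ s} => (x i : V) := by
      ext v
      simp
    have h2 : LinearIndependent F fun i : {i // i ∉ s} => (x i : V) :=
      (hix.map' X.1.subtype (Submodule.ker_subtype _)).comp _ Subtype.val_injective
    have h3 := finrank_span_eq_card h2
    rw [← h1, hspan, Fintype.card_subtype_compl, Fintype.card_fin, Fintype.card_coe] at h3
    have h4 := Finset.card_le_univ s
    rw [Fintype.card_fin] at h4
    unfold codimInter
    rw [h3, hX]
    omega
  refine ⟨hcodim, ?_⟩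
  have hcard : Fintype.card {i : Fin n // (i : ℕ) < s.card} = Fintype.card {i // i ∈ s} := by
    have h4 := Finset.card_le_univ s
    rw [Fintype.card_fin] at h4
    rw [Fintype.card_coe, Fintype.card_fin_lt_of_le h4]
  -- `IsAdapted` wants the dual part at the initial indices. A permutation takes them to `s`; its
  -- sign enters through both forms δ and cancels.
  let e : {i : Fin n // (i : ℕ) < s.card} ≃ {i // i ∈ s} := Fintype.equivOfCardEq hcard
  let π : Equiv.Perm (Fin n) := e.extendSubtype
  have hπ : ∀ i : Fin n, s.card ≤ i → π i ∉ s := fun i hi =>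
    e.extendSubtype_not_mem i (not_lt.2 hi)
  have had : IsAdapted (bx.reindex π.symm) (bY.reindex π.symm) := by
    constructor
    · intro i hi
      rw [hcodim] at hi
      rw [Module.Basis.reindex_apply, Module.Basis.reindex_apply, hcx, hcy, Equiv.symm_symm,
        hxy _ (hπ i hi)]
    · rw [← hspan]
      congr 1
      ext v
      constructor
      · rintro ⟨i, hi, rfl⟩
        rw [hcodim] at hi
        exact ⟨π i, hπ i hi, by rw [Module.Basis.reindex_apply, hcx, Equiv.symm_symm]⟩
      · rintro ⟨i, hi, rfl⟩
        refine ⟨π.symm i, ?_, by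
          rw [Module.Basis.reindex_apply, hcx, Equiv.symm_symm, Equiv.apply_symm_apply]⟩
        rw [hcodim]
        by_contra hlt
        have := e.extendSubtype_mem (π.symm i) (not_le.1 hlt)
        exact hi (by simpa [π] using this)
  have hval : maslovValue δ (bx.reindex π.symm) (bY.reindex π.symm) = c := by
    unfold maslovValue
    have h1 : δ X (bx.reindex π.symm) = Equiv.Perm.sign π • δ X x := by
      rw [← (δ X).map_perm, Module.Basis.coe_reindex, hcx, Equiv.symm_symm]
    have h2 : δ Y (bY.reindex π.symm) = Equiv.Perm.sign π • δ Y y := by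
      rw [← (δ Y).map_perm, Module.Basis.coe_reindex, hcy, Equiv.symm_symm]
    let e' : {i : Fin n // (i : ℕ) < codimInter X Y} ≃ s :=
      (Equiv.subtypeEquivRight fun i => by rw [hcodim]).trans e
    have h3 : (Matrix.of fun i j : {i : Fin n // (i : ℕ) < codimInter X Y} =>
        B (bx.reindex π.symm i.1 : V) (bY.reindex π.symm j.1 : V)) =
        (Matrix.of fun i j : s => B (x i : V) (y j : V)).submatrix e' e' := by
      have hπe : ∀ i : {i : Fin n // (i : ℕ) < codimInter X Y}, π i.1 = (e' i : Fin n) :=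
        fun i => e.extendSubtype_apply_of_mem i.1 (by rw [← hcodim]; exact i.2)
      ext i j
      rw [of_apply, submatrix_apply, of_apply, Module.Basis.reindex_apply,
        Module.Basis.reindex_apply, hcx, hcy, Equiv.symm_symm, hπe, hπe]
    rw [h1, h2, h3, det_submatrix_equiv_self, hc, Units.smul_def, Units.smul_def]
    rcases Int.units_eq_one_or (Equiv.Perm.sign π) with h | h <;> rw [h] <;> simp
  unfold maslov
  have hiff : (∃ (x : Module.Basis (Fin n) F X.1) (y : Module.Basis (Fin n) F Y.1),
      IsAdapted x y ∧ quadraticChar F (maslovValue δ x y) = 1) ↔ quadraticChar F c = 1 := by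
    constructor
    · rintro ⟨x', y', h', h1⟩
      obtain ⟨t, ht0, ht⟩ := exists_maslovValue_eq_sq_mul δ had h'
      rwa [ht, hval, map_mul, map_pow, quadraticChar_sq_one ht0, one_mul] at h1
    · intro h1
      exact ⟨_, _, had, by rw [hval, h1]⟩
  rcases quadraticChar_dichotomy hc0 with h | h
  · rw [if_pos (by convert hiff.2 h), h]
    rfl
  · rw [if_neg, h]
    · rfl
    · intro h1
      have : quadraticChar F c = 1 := hiff.1 (by convert h1)
      rw [h] at this
      exact absurd this (by decide)

end MaslovIndex

/-! ### Neighbours of a generator, and dual families for a pair -/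

section Neighbours

variable {F V : Type*} [Field F] [AddCommGroup V] [Module F V] {B : LinearMap.BilinForm F V}

/-- The generator `(X ∩ v^⊥) + ⟨v⟩`. -/
noncomputable def Generator.neighbour (hB : B.IsAlt) (X : Generator B) (v : V) : Generator B :=
  ⟨(X.1 ⊓ LinearMap.ker (B v)) ⊔ Submodule.span F {v}, by
    have hskew : ∀ a b, B a b = 0 → B b a = 0 := fun a b h => hB.isRefl a b h
    apply le_antisymm
    · intro m hm
      have hmv : B v m = 0 := hm v (Submodule.mem_sup_right (Submodule.mem_span_singleton_self v))
      have hmu : ∀ u ∈ X.1, B v u = 0 → B u m = 0 := fun u hu huv =>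
        hm u (Submodule.mem_sup_left ⟨hu, huv⟩)
      by_cases hv : v ∈ X.1
      · exact Submodule.mem_sup_left ⟨X.mem_of_forall fun u hu => hmu u hu (X.isotropic hv hu), hmv⟩
      · have : ∃ x₀ ∈ X.1, B v x₀ ≠ 0 := by
          by_contra! h
          exact hv (X.mem_of_forall fun x hx => hskew _ _ (h x hx))
        obtain ⟨x₀, hx₀, hne⟩ := this
        have hne' : B x₀ v ≠ 0 := fun h => hne (hskew _ _ h)
        -- The coefficient makes the difference orthogonal to x₀. As X is spanned by x₀ and X ∩ v^⊥,
        -- the difference is then orthogonal to X.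
        have hm' : m - (B x₀ m / B x₀ v) • v ∈ X.1 := by
          refine X.mem_of_forall fun x hx => ?_
          have h1 := hmu (x - (B v x / B v x₀) • x₀)
            (X.1.sub_mem hx (X.1.smul_mem _ hx₀)) (by
              rw [map_sub, map_smul, smul_eq_mul, div_mul_cancel₀ _ hne, sub_self])
          have h2 : B x v / B x₀ v = B v x / B v x₀ := by
            rw [← hB.neg_eq v x, ← hB.neg_eq v x₀, neg_div_neg_eq]
          rw [map_sub, map_smul, LinearMap.sub_apply, LinearMap.smul_apply, smul_eq_mul,
            ← h2] at h1
          rw [map_sub, map_smul, smul_eq_mul, ← h1]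
          ring
        have hsplit : m = (m - (B x₀ m / B x₀ v) • v) + (B x₀ m / B x₀ v) • v := by abel
        rw [hsplit]
        refine Submodule.add_mem_sup ⟨hm', ?_⟩
          (Submodule.smul_mem _ _ (Submodule.mem_span_singleton_self v))
        change B v (m - (B x₀ m / B x₀ v) • v) = 0
        rw [map_sub, map_smul, hmv, hB v, smul_zero, sub_zero]
    · refine sup_le ?_ ?_
      · rintro m ⟨hm, hmv⟩ w hw
        obtain ⟨u, ⟨hu, -⟩, t, ht, rfl⟩ := Submodule.mem_sup.1 hw
        obtain ⟨c, rfl⟩ := Submodule.mem_span_singleton.1 ht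
        change B (u + c • v) m = 0
        rw [map_add, map_smul, LinearMap.add_apply, LinearMap.smul_apply, X.isotropic hu hm,
          LinearMap.mem_ker.1 hmv, smul_zero, add_zero]
      · rw [Submodule.span_singleton_le_iff_mem]
        intro w hw
        obtain ⟨u, ⟨-, hu⟩, t, ht, rfl⟩ := Submodule.mem_sup.1 hw
        obtain ⟨c, rfl⟩ := Submodule.mem_span_singleton.1 ht
        change B (u + c • v) v = 0
        rw [map_add, map_smul, LinearMap.add_apply, LinearMap.smul_apply, hB v,
          hskew _ _ (LinearMap.mem_ker.1 hu), smul_zero, add_zero]⟩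

namespace Generator

variable (hB : B.IsAlt)

theorem self_mem_neighbour (X : Generator B) (v : V) : v ∈ (X.neighbour hB v).1 :=
  Submodule.mem_sup_right (Submodule.mem_span_singleton_self v)

theorem mem_neighbour {X : Generator B} {v u : V} (hu : u ∈ X.1) (h : B v u = 0) :
    u ∈ (X.neighbour hB v).1 :=
  Submodule.mem_sup_left ⟨hu, h⟩

/-- A generator containing `v` and `X ∩ v^⊥` is the neighbour of `X` through `v`. -/
theorem neighbour_eq {X Z : Generator B} {v : V} (hv : v ∈ Z.1)
    (h : ∀ u ∈ X.1, B v u = 0 → u ∈ Z.1) : X.neighbour hB v = Z :=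
  eq_of_le (sup_le (fun u hu => h u hu.1 hu.2)
    ((Submodule.span_singleton_le_iff_mem _ _).2 hv))

theorem neighbour_add {X : Generator B} {x v : V} (hx : x ∈ X.1) (h : B v x = 0) :
    X.neighbour hB (x + v) = X.neighbour hB v := by
  apply neighbour_eq
  · exact add_mem (mem_neighbour hB hx h) (self_mem_neighbour hB X v)
  · intro u hu huv
    rw [map_add, LinearMap.add_apply, X.isotropic hx hu, zero_add] at huv
    exact mem_neighbour hB hu huv

end Generator

/-- A basis whose members off a set `s` lie in `N`, whose coordinates on `s` vanish on `N`, and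
which has a prescribed member outside `N`. -/
theorem exists_basis_adapted_to_submodule {W : Type*} [AddCommGroup W] [Module F W]
    [FiniteDimensional F W] {n : ℕ} (hW : Module.finrank F W = n) (N : Submodule F W) {w : W}
    (hw : w ∉ N) :
    ∃ (b : Module.Basis (Fin n) F W) (s : Finset (Fin n)) (i₀ : Fin n), i₀ ∈ s ∧ b i₀ = w ∧
      (∀ i ∉ s, b i ∈ N) ∧ ∀ i ∈ s, N ≤ LinearMap.ker (b.coord i) := by
  classical
  let bN := Module.finBasis F N
  let S₀ : Set W := Set.range fun i => (bN i : W)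
  have hS₀ : Submodule.span F S₀ = N := by
    have : S₀ = N.subtype '' Set.range bN := by
      ext v
      simp [S₀]
    rw [this, Submodule.span_image, bN.span_eq, Submodule.map_top, Submodule.range_subtype]
  have hli : LinearIndepOn F id S₀ :=
    (bN.linearIndependent.map' N.subtype (Submodule.ker_subtype _)).linearIndepOn_id
  have hins : LinearIndepOn F id (insert w S₀) := hli.id_insert (by rwa [hS₀])
  let b' := Module.Basis.extend hins
  have hsub : insert w S₀ ⊆ hins.extend (Set.subset_univ _) := hins.subset_extend _
  let e := b'.indexEquiv (Module.finBasisOfFinrankEq F W hW)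
  have hb : ∀ i, b'.reindex e i = (e.symm i : W) := by
    intro i
    rw [Module.Basis.reindex_apply]
    exact Module.Basis.extend_apply_self hins _
  let iw : hins.extend (Set.subset_univ _) := ⟨w, hsub (Set.mem_insert _ _)⟩
  refine ⟨b'.reindex e, Finset.univ.filter fun i => (e.symm i : W) ∉ S₀, e iw, ?_, ?_, ?_, ?_⟩
  · rw [Finset.mem_filter]
    refine ⟨Finset.mem_univ _, ?_⟩
    rw [Equiv.symm_apply_apply]
    intro h
    exact hw (hS₀ ▸ Submodule.subset_span h)
  · rw [hb, Equiv.symm_apply_apply]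
  · intro i hi
    have hi' : (e.symm i : W) ∈ S₀ := by simpa using hi
    rw [hb]
    exact hS₀ ▸ Submodule.subset_span hi'
  · intro i hi
    have hi' : (e.symm i : W) ∉ S₀ := by simpa using hi
    rw [← hS₀, Submodule.span_le]
    intro v hv
    have hv' : v = b'.reindex e (e ⟨v, hsub (Set.mem_insert_of_mem _ hv)⟩) := by
      rw [hb, Equiv.symm_apply_apply]
    rw [SetLike.mem_coe, LinearMap.mem_ker, Module.Basis.coord_apply, hv', Module.Basis.repr_self,
      Finsupp.single_eq_of_ne]
    rintro rfl
    rw [Equiv.symm_apply_apply] at hi'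
    exact hi' hv

/-- Take a basis of Y adapted to X ∩ Y. Its coordinate forms on `s` kill X ∩ Y, hence come from
functionals on V/X, because Y/(X ∩ Y) embeds there. Representing such a functional by B gives a
vector orthogonal to X, that is, in X. -/
theorem exists_dual_families [FiniteDimensional F V] {n : ℕ} (hV : Module.finrank F V = 2 * n)
    (hB : B.IsAlt) (hB' : B.Nondegenerate) (X Y : Generator B) {w : V} (hw : w ∈ Y.1)
    (hwX : w ∉ X.1) :
    ∃ (x : Fin n → X.1) (y : Fin n → Y.1) (s : Finset (Fin n)) (i₀ : Fin n), i₀ ∈ s ∧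
      (y i₀ : V) = w ∧ (∀ i ∉ s, (x i : V) = (y i : V)) ∧
      (∀ i ∈ s, ∀ j, B (x i : V) (y j : V) = if i = j then 1 else 0) ∧
      LinearIndependent F x ∧ LinearIndependent F y := by
  obtain ⟨b, s, i₀, hi₀, hbi, hbs, hker⟩ := exists_basis_adapted_to_submodule
    (Y.finrank_eq hV hB') (X.1.comap Y.1.subtype) (w := ⟨w, hw⟩) hwX
  have hex : ∀ i, ∃ x : X.1, (i ∉ s → (x : V) = (b i : V)) ∧
      (i ∈ s → ∀ j, B (x : V) (b j : V) = if i = j then 1 else 0) := by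
    intro i
    by_cases hi : i ∈ s
    · have hmem : b.coord i ∈ LinearMap.range (X.1.mkQ ∘ₗ Y.1.subtype).dualMap := by
        rw [LinearMap.range_dualMap_eq_dualAnnihilator_ker, Submodule.mem_dualAnnihilator]
        intro v hv
        apply hker i hi
        rwa [LinearMap.mem_ker, LinearMap.comp_apply, Submodule.mkQ_apply,
          Submodule.Quotient.mk_eq_zero] at hv
      obtain ⟨φ, hφ⟩ := hmem
      let x₀ := (B.toDual hB').symm (φ ∘ₗ X.1.mkQ)
      have hx₀ : ∀ v, B x₀ v = φ (X.1.mkQ v) := by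
        intro v
        rw [← LinearMap.BilinForm.toDual_def hB', LinearEquiv.apply_symm_apply,
          LinearMap.comp_apply]
      have hx₀X : x₀ ∈ X.1 := by
        refine X.mem_of_forall fun u hu => hB.isRefl _ _ ?_
        rw [hx₀, Submodule.mkQ_apply, (Submodule.Quotient.mk_eq_zero _).2 hu, map_zero]
      refine ⟨⟨x₀, hx₀X⟩, fun h => absurd hi h, fun _ j => ?_⟩
      have h1 : B x₀ (b j : V) = b.coord i (b j) := by
        rw [hx₀, ← hφ]
        rfl
      rw [h1, Module.Basis.coord_apply, Module.Basis.repr_self, Finsupp.single_apply]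
      simp only [eq_comm]
    · exact ⟨⟨(b i : V), hbs i hi⟩, fun _ => rfl, fun h => absurd h hi⟩
  choose x hx1 hx2 using hex
  refine ⟨x, b, s, i₀, hi₀, by rw [hbi], fun i hi => hx1 i hi, fun i hi => hx2 i hi, ?_,
    b.linearIndependent⟩
  rw [Fintype.linearIndependent_iff]
  intro g hg
  have hg' : ∑ i, g i • (x i : V) = 0 := by
    have := congrArg Subtype.val hg
    simpa only [Submodule.coe_sum, Submodule.coe_smul, Submodule.coe_zero] using this
  have hs : ∀ j ∈ s, g j = 0 := by
    intro j hj
    have h1 := congrArg (fun v => B v (b j : V)) hg'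
    simp only [map_sum, map_smul, LinearMap.sum_apply, LinearMap.smul_apply, smul_eq_mul,
      map_zero, LinearMap.zero_apply] at h1
    rw [Finset.sum_eq_single j] at h1
    · rwa [hx2 j hj, if_pos rfl, mul_one] at h1
    · intro i _ hij
      by_cases hi : i ∈ s
      · rw [hx2 i hi, if_neg hij, mul_zero]
      · rw [hx1 i hi, Y.isotropic (b i).2 (b j).2, mul_zero]
    · simp
  refine Fintype.linearIndependent_iff.1 b.linearIndependent g ?_
  apply Subtype.ext
  rw [Submodule.coe_sum, Submodule.coe_zero, ← hg']
  refine Finset.sum_congr rfl fun i _ => ?_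
  rw [Submodule.coe_smul]
  by_cases hi : i ∈ s
  · rw [hs i hi, zero_smul, zero_smul]
  · rw [hx1 i hi]

end Neighbours

/-! ### Maslov indices along an edge of the dual polar graph -/

section Signs

open Matrix

variable {F V : Type*} [Field F] [AddCommGroup V] [Module F V] [FiniteDimensional F V]
  {B : LinearMap.BilinForm F V} {n : ℕ} (hV : Module.finrank F V = 2 * n) (hB : B.IsAlt)
  (hB' : B.Nondegenerate)

include hV hB hB'

/-- Exchanging the vector dual to w for v turns the family of X into one of Z, so a single set of
vectors computes all three indices of X, Y and Z. -/
theorem exists_neighbour_families (X Y : Generator B) {w x v : V} (hw : w ∈ Y.1) (hwX : w ∉ X.1)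
    (hx : x ∈ X.1) (hv : v = x + w) {Z : Generator B} (hZ : X.neighbour hB v = Z) :
    ∃ (a : Fin n → X.1) (b : Fin n → Y.1) (c : Fin n → Z.1)
      (s : Finset (Fin n)) (i₀ : Fin n), i₀ ∈ s ∧ (b i₀ : V) = w ∧
      (∀ i ∉ s, (a i : V) = (b i : V)) ∧
      (∀ i ∈ s, ∀ j, B (a i : V) (b j : V) = if i = j then 1 else 0) ∧
      (c i₀ : V) = v ∧ (∀ i, i ≠ i₀ → (c i : V) = (a i : V)) ∧
      LinearIndependent F a ∧ LinearIndependent F b ∧ LinearIndependent F c := by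
  subst hv hZ
  obtain ⟨a, b, s, i₀, hi₀, hbw, hab, hdual, ha, hb⟩ :=
    exists_dual_families hV hB hB' X Y hw hwX
  have hmem : ∀ i, i ≠ i₀ → (a i : V) ∈ (X.neighbour hB (x + w)).1 := by
    intro i hi
    apply Generator.mem_neighbour hB (a i).2
    rw [map_add, LinearMap.add_apply, X.isotropic hx (a i).2, zero_add]
    apply hB.isRefl
    rw [← hbw]
    by_cases his : i ∈ s
    · rw [hdual i his, if_neg hi]
    · rw [hab i his, Y.isotropic (b i).2 (b i₀).2]
  let c : Fin n → (X.neighbour hB (x + w)).1 := fun i =>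
    if h : i = i₀ then ⟨x + w, Generator.self_mem_neighbour hB X _⟩ else ⟨a i, hmem i h⟩
  have hc₀ : (c i₀ : V) = x + w := by simp [c]
  have hc : ∀ i, i ≠ i₀ → (c i : V) = (a i : V) := fun i hi => by simp [c, hi]
  refine ⟨a, b, c, s, i₀, hi₀, hbw, hab, hdual, hc₀, hc, ha, hb, ?_⟩
  rw [Fintype.linearIndependent_iff]
  intro g hg
  have hg' : ∑ i, g i • (c i : V) = 0 := by
    have := congrArg Subtype.val hg
    simpa only [Submodule.coe_sum, Submodule.coe_smul, Submodule.coe_zero] using this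
  have hg₀ : g i₀ = 0 := by
    have h1 := congrArg (B (a i₀ : V)) hg'
    simp only [map_sum, map_smul, smul_eq_mul, map_zero] at h1
    rw [Finset.sum_eq_single i₀] at h1
    · rwa [hc₀, map_add, X.isotropic (a i₀).2 hx, ← hbw, hdual i₀ hi₀, if_pos rfl, zero_add,
        mul_one] at h1
    · intro i _ hi
      rw [hc i hi, X.isotropic (a i₀).2 (a i).2, mul_zero]
    · simp
  refine Fintype.linearIndependent_iff.1 ha g ?_
  apply Subtype.ext
  rw [Submodule.coe_sum, Submodule.coe_zero, ← hg']
  refine Finset.sum_congr rfl fun i _ => ?_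
  rw [Submodule.coe_smul]
  by_cases hi : i = i₀
  · rw [hi, hg₀, zero_smul, zero_smul]
  · rw [hc i hi]

omit hB in
theorem codimInter_comm (X Y : Generator B) : codimInter X Y = codimInter Y X := by
  unfold codimInter
  rw [X.finrank_eq hV hB', Y.finrank_eq hV hB', inf_comm]

variable {δ : (X : Generator B) → X.1 [⋀^Fin n]→ₗ[F] F} (hδ : ∀ X, δ X ≠ 0) [Fintype F]

include hδ

omit hB in
theorem codimInter_self_and_maslov_self (X : Generator B) :
    codimInter X X = 0 ∧ maslov δ X X = 1 := by
  classical
  have hX := X.finrank_eq hV hB'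
  let b := Module.finBasisOfFinrankEq F X.1 hX
  have hb := map_ne_zero_of_linearIndependent δ hX (hδ X) b.linearIndependent
  have h := codimInter_eq_and_maslov_eq δ hX hX b b ∅ (fun _ _ => rfl) rfl
    (by rw [det_isEmpty, mul_one]; exact mul_ne_zero hb hb)
  refine ⟨h.1, ?_⟩
  have h2 := h.2
  rw [det_isEmpty, mul_one, map_mul, ← sq, quadraticChar_sq_one hb] at h2
  exact Units.ext h2

variable (hq : Fintype.card F % 4 = 1)

include hq

omit [FiniteDimensional F V] hV hB hB' hδ in
theorem quadraticChar_neg_one_pow [DecidableEq F] (m : ℕ) :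
    quadraticChar F ((-1) ^ m) = 1 := by
  have h : quadraticChar F (-1) = 1 := by
    rw [quadraticChar_one_iff_isSquare (neg_ne_zero.2 one_ne_zero),
      FiniteField.isSquare_neg_one_iff]
    omega
  rw [map_pow, h, one_pow]

/-- Exchanging X and Y negates and transposes the Gram matrix. This costs a power of χ(-1), which is
1 as q ≡ 1 mod 4. -/
theorem maslov_comm (X Y : Generator B) : maslov δ X Y = maslov δ Y X := by
  classical
  by_cases hle : Y.1 ≤ X.1
  · rw [Generator.eq_of_le hle]
  obtain ⟨w, hw, hwX⟩ := SetLike.not_le_iff_exists.1 hle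
  obtain ⟨a, b, s, i₀, hi₀, hbw, hab, hdual, ha, hb⟩ :=
    exists_dual_families hV hB hB' X Y hw hwX
  have hX := X.finrank_eq hV hB'
  have hY := Y.finrank_eq hV hB'
  have ha' := map_ne_zero_of_linearIndependent δ hX (hδ X) ha
  have hb' := map_ne_zero_of_linearIndependent δ hY (hδ Y) hb
  have hd1 : (Matrix.of fun i j : s => B (a i : V) (b j : V)).det = 1 := by
    rw [← det_one (n := s)]
    congr 1
    ext i j
    rw [of_apply, hdual i i.2, one_apply]
    simp only [Subtype.ext_iff]
  have hd2 : (Matrix.of fun i j : s => B (b i : V) (a j : V)).det = (-1) ^ s.card := by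
    have h := det_neg (of fun i j : s => B (a i : V) (b j : V))ᵀ
    rw [det_transpose, hd1, mul_one, Fintype.card_coe] at h
    rw [← h]
    congr 1
    ext i j
    rw [of_apply, neg_apply, transpose_apply, of_apply, hB.neg_eq]
  have h1 := (codimInter_eq_and_maslov_eq δ hX hY a b s hab rfl
    (by rw [hd1, mul_one]; exact mul_ne_zero ha' hb')).2
  have h2 := (codimInter_eq_and_maslov_eq δ hY hX b a s (fun i hi => (hab i hi).symm) rfl
    (by
      rw [hd2]
      exact mul_ne_zero (mul_ne_zero hb' ha') (pow_ne_zero _ (neg_ne_zero.2 one_ne_zero)))).2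
  apply Units.ext
  rw [h1, h2, hd1, hd2, map_mul, map_mul _ (_ * _) ((-1) ^ _), quadraticChar_neg_one_pow hq, map_one,
    mul_comm (δ X a)]

omit hq in
/-- The neighbour of `X` through `x + w`, with `x ∈ X`, `w ∈ Y` and `B x w ≠ 0`, is as far from
`Y` as `X` is, and `χ (B x w)` compares the Maslov indices. -/
theorem neighbour_add_of_ne_zero [DecidableEq F] (X Y : Generator B) {w x : V} (hw : w ∈ Y.1)
    (hwX : w ∉ X.1) (hx : x ∈ X.1) (hxw : B x w ≠ 0) :
    codimInter (X.neighbour hB (x + w)) Y = codimInter X Y ∧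
      ((maslov δ X (X.neighbour hB (x + w)) * maslov δ (X.neighbour hB (x + w)) Y : ℤˣ) : ℤ) =
        maslov δ X Y * quadraticChar F (B x w) := by
  obtain ⟨Z, hXZ⟩ : ∃ Z, X.neighbour hB (x + w) = Z := ⟨_, rfl⟩
  rw [hXZ]
  obtain ⟨a, b, c, s, i₀, hi₀, hbw, hab, hdual, hc₀, hc, ha, hb, hcl⟩ :=
    exists_neighbour_families hV hB hB' X Y hw hwX hx rfl hXZ
  have hX := X.finrank_eq hV hB'
  have hY := Y.finrank_eq hV hB'
  have hZ := Z.finrank_eq hV hB'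
  have ha' := map_ne_zero_of_linearIndependent δ hX (hδ X) ha
  have hb' := map_ne_zero_of_linearIndependent δ hY (hδ Y) hb
  have hc' := map_ne_zero_of_linearIndependent δ hZ (hδ Z) hcl
  have hd1 : (Matrix.of fun i j : s => B (a i : V) (b j : V)).det = 1 := by
    rw [← det_one (n := s)]
    congr 1
    ext i j
    rw [of_apply, hdual i i.2, one_apply]
    simp only [Subtype.ext_iff]
  have hd2 : (Matrix.of fun i j : ({i₀} : Finset (Fin n)) => B (a i : V) (c j : V)).det = 1 := by
    rw [det_eq_elem_of_subsingleton _ ⟨i₀, Finset.mem_singleton_self _⟩, of_apply, hc₀, map_add,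
      X.isotropic (a i₀).2 hx, ← hbw, hdual i₀ hi₀, if_pos rfl, zero_add]
  -- The Gram matrix of Z against Y is the identity with the row of i₀ replaced by the values B(x,
  -- b_j); its determinant is the diagonal entry of that row.
  have hd3 : (Matrix.of fun i j : s => B (c i : V) (b j : V)).det = B x w := by
    have : (Matrix.of fun i j : s => B (c i : V) (b j : V)) =
        (1 : Matrix s s F).updateRow ⟨i₀, hi₀⟩ fun j => B x (b j : V) := by
      ext i j
      by_cases hi : i = ⟨i₀, hi₀⟩
      · rw [hi, updateRow_self, of_apply, hc₀, map_add, LinearMap.add_apply, Y.isotropic hw (b j).2,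
          add_zero]
      · have hi' : (i : Fin n) ≠ i₀ := fun h => hi (Subtype.ext h)
        rw [updateRow_ne hi, of_apply, hc _ hi', hdual i i.2, one_apply]
        simp only [Subtype.ext_iff]
    rw [this, ← cramer_transpose_apply, transpose_one, cramer_one]
    change B x (b i₀ : V) = _
    rw [hbw]
  have h1 := codimInter_eq_and_maslov_eq δ hX hY a b s hab rfl
    (by rw [hd1, mul_one]; exact mul_ne_zero ha' hb')
  have h2 := codimInter_eq_and_maslov_eq δ hX hZ a c {i₀}
    (fun i hi => (hc i (by simpa using hi)).symm) rfl
    (by rw [hd2, mul_one]; exact mul_ne_zero ha' hc')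
  have h3 := codimInter_eq_and_maslov_eq δ hZ hY c b s
    (fun i hi => by rw [hc i (fun h => hi (h ▸ hi₀)), hab i hi]) rfl
    (by rw [hd3]; exact mul_ne_zero (mul_ne_zero hc' hb') hxw)
  refine ⟨by rw [h1.1, h3.1], ?_⟩
  rw [Units.val_mul, h1.2, h2.2, h3.2, hd1, hd2, hd3]
  simp only [map_mul, mul_one]
  -- The form of Z occurs in both indices on the left, so its character is squared away.
  linear_combination quadraticChar F (δ X a) * quadraticChar F (δ Y b) * quadraticChar F (B x w) *
    quadraticChar_sq_one hc'

omit hq in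
/-- The neighbour of `X` through `w ∈ Y` is closer to `Y` than `X` is. -/
theorem neighbour_of_mem (X Y : Generator B) {w : V} (hw : w ∈ Y.1) (hwX : w ∉ X.1) :
    codimInter X (X.neighbour hB w) = 1 ∧
      codimInter (X.neighbour hB w) Y + 1 = codimInter X Y ∧
      maslov δ X (X.neighbour hB w) * maslov δ (X.neighbour hB w) Y = maslov δ X Y := by
  classical
  obtain ⟨Z, hXZ⟩ : ∃ Z, X.neighbour hB w = Z := ⟨_, rfl⟩
  rw [hXZ]
  obtain ⟨a, b, c, s, i₀, hi₀, hbw, hab, hdual, hc₀, hc, ha, hb, hcl⟩ :=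
    exists_neighbour_families hV hB hB' X Y hw hwX X.1.zero_mem (zero_add w).symm hXZ
  have hX := X.finrank_eq hV hB'
  have hY := Y.finrank_eq hV hB'
  have hZ := Z.finrank_eq hV hB'
  have ha' := map_ne_zero_of_linearIndependent δ hX (hδ X) ha
  have hb' := map_ne_zero_of_linearIndependent δ hY (hδ Y) hb
  have hc' := map_ne_zero_of_linearIndependent δ hZ (hδ Z) hcl
  have hd1 : (Matrix.of fun i j : s => B (a i : V) (b j : V)).det = 1 := by
    rw [← det_one (n := s)]
    congr 1
    ext i j
    rw [of_apply, hdual i i.2, one_apply]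
    simp only [Subtype.ext_iff]
  have hd2 : (Matrix.of fun i j : ({i₀} : Finset (Fin n)) => B (a i : V) (c j : V)).det = 1 := by
    rw [det_eq_elem_of_subsingleton _ ⟨i₀, Finset.mem_singleton_self _⟩, of_apply, hc₀,
      ← hbw, hdual i₀ hi₀, if_pos rfl]
  have hd3 : (Matrix.of fun i j : (s.erase i₀ : Finset (Fin n)) =>
      B (c i : V) (b j : V)).det = 1 := by
    rw [← det_one (n := (s.erase i₀ : Finset (Fin n)))]
    congr 1
    ext i j
    have hi := Finset.mem_erase.1 i.2
    rw [of_apply, hc _ hi.1, hdual i hi.2, one_apply]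
    simp only [Subtype.ext_iff]
  have h1 := codimInter_eq_and_maslov_eq δ hX hY a b s hab rfl
    (by rw [hd1, mul_one]; exact mul_ne_zero ha' hb')
  have h2 := codimInter_eq_and_maslov_eq δ hX hZ a c {i₀}
    (fun i hi => (hc i (by simpa using hi)).symm) rfl
    (by rw [hd2, mul_one]; exact mul_ne_zero ha' hc')
  have h3 := codimInter_eq_and_maslov_eq δ hZ hY c b (s.erase i₀)
    (fun i hi => by
      by_cases h : i = i₀
      · rw [h, hc₀, hbw]
      · rw [hc i h, hab i fun his => hi (Finset.mem_erase.2 ⟨h, his⟩)]) rfl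
    (by rw [hd3, mul_one]; exact mul_ne_zero hc' hb')
  refine ⟨by rw [h2.1, Finset.card_singleton],
    by rw [h1.1, h3.1, Finset.card_erase_add_one hi₀], ?_⟩
  apply Units.ext
  rw [Units.val_mul, h1.2, h2.2, h3.2, hd1, hd2, hd3]
  simp only [map_mul, mul_one]
  linear_combination quadraticChar F (δ X a) * quadraticChar F (δ Y b) * quadraticChar_sq_one hc'

/-- The neighbour of `X` through a vector outside `(X ∩ Y)^⊥` is farther from `Y` than `X` is. -/
theorem neighbour_of_exists_ne_zero (X Y : Generator B) {v u : V} (huX : u ∈ X.1) (huY : u ∈ Y.1)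
    (huv : B u v ≠ 0) :
    codimInter (X.neighbour hB v) Y = codimInter X Y + 1 ∧
      maslov δ X (X.neighbour hB v) * maslov δ (X.neighbour hB v) Y = maslov δ X Y := by
  set Z := X.neighbour hB v
  have huZ : u ∉ Z.1 := fun h => huv (Z.isotropic h (Generator.self_mem_neighbour hB X v))
  -- Seen from Z, the generator X is the neighbour through u, which lies in Y but not in Z. So the
  -- step from Z to X is one towards Y, already treated.
  have hXZ : Z.neighbour hB u = X := by
    apply Generator.neighbour_eq hB huX
    intro z hz huz
    obtain ⟨t, ⟨ht, -⟩, c', hc', rfl⟩ := Submodule.mem_sup.1 hz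
    obtain ⟨c, rfl⟩ := Submodule.mem_span_singleton.1 hc'
    rw [map_add, map_smul, X.isotropic huX ht, zero_add, smul_eq_mul] at huz
    rw [(mul_eq_zero.1 huz).resolve_right huv, zero_smul, add_zero]
    exact ht
  obtain ⟨-, h1, h2⟩ := neighbour_of_mem hV hB hB' hδ Z Y huY huZ
  rw [hXZ] at h1 h2
  refine ⟨h1.symm, ?_⟩
  rw [← h2, ← mul_assoc, maslov_comm hV hB hB' hδ hq X Z, Int.units_mul_self, one_mul]

end Signs

/-! ### Graph distance equals codimension of the intersection -/

section Distance

variable {F V : Type*} [Field F] [AddCommGroup V] [Module F V] {B : LinearMap.BilinForm F V}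
  {n : ℕ} (hV : Module.finrank F V = 2 * n) (hB : B.IsAlt)
  (hB' : B.Nondegenerate)

theorem codimInter_self (X : Generator B) : codimInter X X = 0 := by
  rw [codimInter, inf_idem, Nat.sub_self]

variable [FiniteDimensional F V]

include hV hB'

theorem finrank_inf_eq (X Y : Generator B) :
    Module.finrank F (X.1 ⊓ Y.1 : Submodule F V) = n - codimInter X Y := by
  have h := Submodule.finrank_mono (inf_le_left : X.1 ⊓ Y.1 ≤ X.1)
  unfold codimInter
  rw [X.finrank_eq hV hB'] at *
  omega

theorem codimInter_le (X Y : Generator B) : codimInter X Y ≤ n := by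
  unfold codimInter
  rw [X.finrank_eq hV hB']
  omega

theorem finrank_sup_eq (X Y : Generator B) :
    Module.finrank F (X.1 ⊔ Y.1 : Submodule F V) = n + codimInter X Y := by
  have h := Submodule.finrank_sup_add_finrank_inf_eq X.1 Y.1
  rw [finrank_inf_eq hV hB', X.finrank_eq hV hB', Y.finrank_eq hV hB'] at h
  have := codimInter_le hV hB' X Y
  omega

theorem eq_of_codimInter_eq_zero {X Y : Generator B} (h : codimInter X Y = 0) : X = Y := by
  have h1 := finrank_inf_eq hV hB' X Y
  rw [h, Nat.sub_zero, ← X.finrank_eq hV hB'] at h1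
  exact Generator.eq_of_le (inf_eq_left.1 (Submodule.eq_of_le_of_finrank_eq inf_le_left h1))

/-- A dimension count inside Z: both X ∩ Z and Z ∩ Y lie in Z, and they meet inside X ∩ Y. -/
theorem codimInter_le_add_one {X Y Z : Generator B} (h : codimInter X Z = 1) :
    codimInter X Y ≤ codimInter Z Y + 1 := by
  have h1 := Submodule.finrank_sup_add_finrank_inf_eq (X.1 ⊓ Z.1) (Z.1 ⊓ Y.1)
  have h2 : Module.finrank F ((X.1 ⊓ Z.1) ⊔ (Z.1 ⊓ Y.1) : Submodule F V) ≤ n := by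
    rw [← Z.finrank_eq hV hB']
    exact Submodule.finrank_mono (sup_le inf_le_right inf_le_left)
  have h3 : Module.finrank F ((X.1 ⊓ Z.1) ⊓ (Z.1 ⊓ Y.1) : Submodule F V) ≤
      Module.finrank F (X.1 ⊓ Y.1 : Submodule F V) :=
    Submodule.finrank_mono (inf_le_inf inf_le_left inf_le_right)
  rw [finrank_inf_eq hV hB', finrank_inf_eq hV hB', h] at h1
  rw [finrank_inf_eq hV hB'] at h3
  have := codimInter_le hV hB' X Y
  have := codimInter_le hV hB' Z Y
  omega

theorem dualPolarGraph_adj {X Y : Generator B} :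
    (dualPolarGraph B).Adj X Y ↔ codimInter X Y = 1 :=
  ⟨fun h => h.1, fun h => ⟨h, by rw [← codimInter_comm hV hB', h]⟩⟩

theorem codimInter_le_length {X Y : Generator B} (p : (dualPolarGraph B).Walk X Y) :
    codimInter X Y ≤ p.length := by
  induction p with
  | nil => rw [codimInter_self]; exact Nat.zero_le _
  | cons h p ih =>
    rw [SimpleGraph.Walk.length_cons]
    exact (codimInter_le_add_one hV hB' h.1).trans (Nat.add_le_add_right ih 1)

include hB

theorem exists_walk {δ : (X : Generator B) → X.1 [⋀^Fin n]→ₗ[F] F} [Fintype F]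
    (hδ : ∀ X, δ X ≠ 0) (k : ℕ) :
    ∀ X Y : Generator B, codimInter X Y = k → ∃ p : (dualPolarGraph B).Walk X Y, p.length = k := by
  induction k with
  | zero =>
    intro X Y h
    obtain rfl := eq_of_codimInter_eq_zero hV hB' h
    exact ⟨SimpleGraph.Walk.nil, rfl⟩
  | succ k ih =>
    intro X Y h
    have hle : ¬ Y.1 ≤ X.1 := by
      intro hle
      rw [Generator.eq_of_le hle] at h
      rw [codimInter_self] at h
      omega
    obtain ⟨w, hw, hwX⟩ := SetLike.not_le_iff_exists.1 hle
    obtain ⟨h1, h2, -⟩ := neighbour_of_mem hV hB hB' hδ X Y hw hwX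
    obtain ⟨p, hp⟩ := ih _ Y (Nat.succ_injective (h2.trans h))
    exact ⟨SimpleGraph.Walk.cons ((dualPolarGraph_adj hV hB').2 h1) p, by
      rw [SimpleGraph.Walk.length_cons, hp]⟩

theorem dist_eq_codimInter {δ : (X : Generator B) → X.1 [⋀^Fin n]→ₗ[F] F} [Fintype F]
    (hδ : ∀ X, δ X ≠ 0) (X Y : Generator B) :
    (dualPolarGraph B).dist X Y = codimInter X Y := by
  obtain ⟨p, hp⟩ := exists_walk hV hB hB' hδ _ X Y rfl
  apply le_antisymm
  · rw [← hp]
    exact SimpleGraph.dist_le p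
  · obtain ⟨r, hr⟩ := p.reachable.exists_walk_length_eq_dist
    rw [← hr]
    exact codimInter_le_length hV hB' r

end Distance

/-! ### Counting vectors in subspaces -/

section Counting

open scoped Classical

variable {F V : Type*} [Field F] [AddCommGroup V] [Module F V]

theorem card_filter_mem [Fintype F] [Fintype V] (W : Submodule F V) :
    (Finset.univ.filter fun v : V => v ∈ W).card = Fintype.card F ^ Module.finrank F W := by
  rw [← Module.card_eq_pow_finrank (K := F) (V := W), Fintype.card_subtype]

theorem card_filter_mem_notMem [Fintype F] [Fintype V] (W U : Submodule F V) :
    ((Finset.univ.filter fun v : V => v ∈ W ∧ v ∉ U).card : ℝ) =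
      (Fintype.card F : ℝ) ^ Module.finrank F W -
        (Fintype.card F : ℝ) ^ Module.finrank F (W ⊓ U : Submodule F V) := by
  have h := Finset.card_filter_add_card_filter_not (s := Finset.univ.filter fun v : V => v ∈ W)
    (fun v => v ∈ U)
  rw [Finset.filter_filter, Finset.filter_filter, card_filter_mem] at h
  have h2 := card_filter_mem (W ⊓ U)
  simp only [Submodule.mem_inf] at h2
  rw [h2] at h
  rw [eq_sub_iff_add_eq, add_comm]
  exact_mod_cast h

/-- Summation over `(X + Y) \ X` through representatives `x + y`. -/
theorem sum_sup_sdiff [Fintype F] [Fintype V] (X Y : Submodule F V) (φ : V → ℝ) :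
    (Fintype.card F : ℝ) ^ Module.finrank F (X ⊓ Y : Submodule F V) *
        ∑ v ∈ Finset.univ.filter (fun v : V => v ∈ X ⊔ Y ∧ v ∉ X), φ v =
      ∑ y ∈ Finset.univ.filter (fun v : V => v ∈ Y ∧ v ∉ X),
        ∑ x ∈ Finset.univ.filter (fun v : V => v ∈ X), φ (x + y) := by
  have h1 : ∀ y, ∑ x ∈ Finset.univ.filter (fun v : V => v ∈ X), φ (x + y) =
      ∑ v ∈ Finset.univ.filter (fun v : V => v - y ∈ X), φ v := by
    intro y
    refine Finset.sum_nbij' (fun x => x + y) (fun v => v - y) ?_ ?_ ?_ ?_ ?_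
    · intro x hx
      simpa using hx
    · intro x hx
      simpa using hx
    · intro x _
      exact add_sub_cancel_right x y
    · intro x _
      exact sub_add_cancel x y
    · intro x _
      rfl
  simp only [h1]
  rw [Finset.sum_comm' (t' := Finset.univ.filter (fun v : V => v ∈ X ⊔ Y ∧ v ∉ X))
    (s' := fun v => Finset.univ.filter fun y : V => y ∈ Y ∧ v - y ∈ X), Finset.mul_sum]
  · refine Finset.sum_congr rfl fun v hv => ?_
    obtain ⟨x₀, hx₀, y₀, hy₀, rfl⟩ := Submodule.mem_sup.1 (Finset.mem_filter.1 hv).2.1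
    rw [Finset.sum_const, nsmul_eq_mul]
    congr 1
    rw [← Nat.cast_pow, ← card_filter_mem]
    congr 1
    -- The representatives of a fixed vector x₀ + y₀ differ by the elements of X ∩ Y.
    refine Finset.card_nbij' (fun u => y₀ + u) (fun y => y - y₀) ?_ ?_ ?_ ?_
    · intro u hu
      have hu' := (Finset.mem_filter.1 hu).2
      refine Finset.mem_filter.2 ⟨Finset.mem_univ _, Y.add_mem hy₀ hu'.2, ?_⟩
      have : x₀ + y₀ - (y₀ + u) = x₀ - u := by abel
      rw [this]
      exact X.sub_mem hx₀ hu'.1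
    · intro y hy
      have hy' := (Finset.mem_filter.1 hy).2
      refine Finset.mem_filter.2 ⟨Finset.mem_univ _, ?_, Y.sub_mem hy'.1 hy₀⟩
      have : y - y₀ = x₀ - (x₀ + y₀ - y) := by abel
      change y - y₀ ∈ X
      rw [this]
      exact X.sub_mem hx₀ hy'.2
    · intro u _
      exact add_sub_cancel_left y₀ u
    · intro y _
      exact add_sub_cancel y₀ y
  · intro y v
    simp only [Finset.mem_filter, Finset.mem_univ, true_and]
    constructor
    · rintro ⟨⟨hy, hyX⟩, hvy⟩
      refine ⟨⟨hy, hvy⟩, ?_, fun hv => hyX ?_⟩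
      · rw [← sub_add_cancel v y]
        exact Submodule.add_mem_sup hvy hy
      · have : y = v - (v - y) := by abel
        rw [this]
        exact X.sub_mem hv hvy
    · rintro ⟨⟨hy, hvy⟩, -, hvX⟩
      refine ⟨⟨hy, fun hyX => hvX ?_⟩, hvy⟩
      rw [← sub_add_cancel v y]
      exact X.add_mem hvy hyX

end Counting

/-! ### Recurrences for sums over neighbours -/

section NeighbourSums

open scoped Classical

variable {F V : Type*} [Field F] [AddCommGroup V] [Module F V] [FiniteDimensional F V]
  {B : LinearMap.BilinForm F V} {n : ℕ} (hV : Module.finrank F V = 2 * n) (hB : B.IsAlt)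
  (hB' : B.Nondegenerate)
  {δ : (X : Generator B) → X.1 [⋀^Fin n]→ₗ[F] F} (hδ : ∀ X, δ X ≠ 0) [Fintype F]

include hV hB hB'

omit [Fintype F] in
theorem neighbour_eq_of_mem {X Z : Generator B} (h : codimInter X Z = 1) {v : V} (hv : v ∈ Z.1)
    (hvX : v ∉ X.1) : X.neighbour hB v = Z := by
  have hle : X.1 ⊓ Z.1 ≤ X.1 ⊓ LinearMap.ker (B v) :=
    fun u hu => ⟨hu.1, Z.isotropic hv hu.2⟩
  have hlt : X.1 ⊓ LinearMap.ker (B v) < X.1 := by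
    refine lt_of_le_of_ne inf_le_left fun heq => hvX (X.mem_of_forall fun u hu => hB.isRefl _ _ ?_)
    rw [← heq] at hu
    exact hu.2
  have h1 := Submodule.finrank_lt_finrank_of_lt hlt
  have h2 := finrank_inf_eq hV hB' X Z
  rw [X.finrank_eq hV hB'] at h1
  have heq := Submodule.eq_of_le_of_finrank_le hle (by omega)
  apply Generator.neighbour_eq hB hv
  intro u hu huv
  have : u ∈ X.1 ⊓ LinearMap.ker (B v) := ⟨hu, huv⟩
  rw [← heq] at this
  exact this.2

include hδ

theorem codimInter_neighbour {X : Generator B} {v : V} (hv : v ∉ X.1) :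
    codimInter X (X.neighbour hB v) = 1 :=
  (neighbour_of_mem hV hB hB' hδ X (X.neighbour hB v)
    (Generator.self_mem_neighbour hB X v) hv).1

/-- Each neighbour Z arises from exactly the vectors of Z \ X, of which there are q^n - q^{n-1}.
Sums over neighbours thus become sums over vectors. -/
theorem sum_neighbours [Fintype V] (X : Generator B) (f : Generator B → ℝ) :
    ((Fintype.card F : ℝ) ^ n - (Fintype.card F : ℝ) ^ (n - 1)) *
        ∑ Z ∈ Finset.univ.filter (fun Z => codimInter X Z = 1), f Z =
      ∑ v ∈ Finset.univ.filter (fun v : V => v ∉ X.1), f (X.neighbour hB v) := by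
  rw [← Finset.sum_fiberwise_of_maps_to (t := Finset.univ.filter fun Z => codimInter X Z = 1)
    (g := fun v => X.neighbour hB v), Finset.mul_sum]
  · refine Finset.sum_congr rfl fun Z hZ => ?_
    have hZ' := (Finset.mem_filter.1 hZ).2
    rw [Finset.filter_filter, Finset.sum_congr (s₂ := Finset.univ.filter
      fun v : V => v ∈ Z.1 ∧ v ∉ X.1) (g := fun _ => f Z), Finset.sum_const, nsmul_eq_mul,
      card_filter_mem_notMem, inf_comm, finrank_inf_eq hV hB', hZ', Z.finrank_eq hV hB']
    · ext v
      simp only [Finset.mem_filter, Finset.mem_univ, true_and]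
      constructor
      · rintro ⟨hv, rfl⟩
        exact ⟨Generator.self_mem_neighbour hB X v, hv⟩
      · rintro ⟨hv, hvX⟩
        exact ⟨hvX, neighbour_eq_of_mem hV hB hB' hZ' hv hvX⟩
    · rintro v hv
      obtain ⟨hv, hvX⟩ := (Finset.mem_filter.1 hv).2
      rw [neighbour_eq_of_mem hV hB hB' hZ' hv hvX]
  · intro v hv
    exact Finset.mem_filter.2 ⟨Finset.mem_univ _,
      codimInter_neighbour hV hB hB' hδ (Finset.mem_filter.1 hv).2⟩

-- By dimension, X + Y is all of (X ∩ Y)^⊥.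
omit hδ hB [Fintype F] in
theorem exists_mem_inf_of_notMem_sup {X Y : Generator B} {v : V} (hv : v ∉ X.1 ⊔ Y.1) :
    ∃ u, u ∈ X.1 ∧ u ∈ Y.1 ∧ B u v ≠ 0 := by
  by_contra! h
  have hle : X.1 ⊔ Y.1 ≤ B.orthogonal (X.1 ⊓ Y.1) :=
    sup_le (fun x hx u hu => X.isotropic hu.1 hx) (fun y hy u hu => Y.isotropic hu.2 hy)
  have heq := Submodule.eq_of_le_of_finrank_eq hle (by
    rw [LinearMap.BilinForm.finrank_orthogonal hB', finrank_sup_eq hV hB', finrank_inf_eq hV hB',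
      hV]
    have := codimInter_le hV hB' X Y
    omega)
  apply hv
  rw [heq]
  exact fun u hu => h u hu.1 hu.2

/-- The sum over the neighbours of `X` of a function with constant value `b` on the neighbours
farther from `Y`, and with constant sum over the neighbours through a coset of `X` that meets
`Y \ X`. -/
theorem sum_neighbours_eq [Fintype V] (X Y : Generator B) (f : Generator B → ℝ) (b t : ℝ)
    (hb : ∀ v ∉ X.1 ⊔ Y.1, f (X.neighbour hB v) = b)
    (ht : ∀ y ∈ Y.1, y ∉ X.1 →
      ∑ x ∈ Finset.univ.filter (fun v : V => v ∈ X.1), f (X.neighbour hB (x + y)) = t) :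
    ((Fintype.card F : ℝ) ^ n - (Fintype.card F : ℝ) ^ (n - 1)) *
        ∑ Z ∈ Finset.univ.filter (fun Z => codimInter X Z = 1), f Z =
      ((Fintype.card F : ℝ) ^ (2 * n) - (Fintype.card F : ℝ) ^ (n + codimInter X Y)) * b +
        ((Fintype.card F : ℝ) ^ codimInter X Y - 1) * t := by
  have hq0 : (Fintype.card F : ℝ) ≠ 0 := by exact_mod_cast Fintype.card_ne_zero
  rw [sum_neighbours hV hB hB' hδ, ← Finset.sum_filter_add_sum_filter_not
    (Finset.univ.filter fun v : V => v ∉ X.1) (fun v => v ∉ X.1 ⊔ Y.1), Finset.filter_filter,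
    Finset.filter_filter]
  congr 1
  · rw [Finset.sum_congr (s₂ := Finset.univ.filter
      fun v : V => v ∈ (⊤ : Submodule F V) ∧ v ∉ X.1 ⊔ Y.1) (g := fun _ => b), Finset.sum_const,
      nsmul_eq_mul, card_filter_mem_notMem, finrank_top, hV, top_inf_eq, finrank_sup_eq hV hB']
    · ext v
      simp only [Finset.mem_filter, Finset.mem_univ, true_and, Submodule.mem_top]
      exact ⟨fun h => h.2, fun h => ⟨fun hX => h (Submodule.mem_sup_left hX), h⟩⟩
    · intro v hv
      exact hb v (Finset.mem_filter.1 hv).2.2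
  · have h1 := sum_sup_sdiff X.1 Y.1 fun v => f (X.neighbour hB v)
    have h3 : ∑ y ∈ Finset.univ.filter (fun v : V => v ∈ Y.1 ∧ v ∉ X.1),
        ∑ x ∈ Finset.univ.filter (fun v : V => v ∈ X.1), f (X.neighbour hB (x + y)) =
        ((Fintype.card F : ℝ) ^ n - (Fintype.card F : ℝ) ^ (n - codimInter X Y)) * t := by
      rw [Finset.sum_congr rfl (g := fun _ => t), Finset.sum_const, nsmul_eq_mul,
        card_filter_mem_notMem, Y.finrank_eq hV hB', inf_comm Y.1, finrank_inf_eq hV hB']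
      intro y hy
      exact ht y (Finset.mem_filter.1 hy).2.1 (Finset.mem_filter.1 hy).2.2
    rw [h3, finrank_inf_eq hV hB'] at h1
    have h2 : (Fintype.card F : ℝ) ^ n =
        (Fintype.card F : ℝ) ^ (n - codimInter X Y) * (Fintype.card F : ℝ) ^ codimInter X Y := by
      rw [← pow_add, Nat.sub_add_cancel (codimInter_le hV hB' X Y)]
    -- With k the codimension, Y \ X has q^n - q^{n-k} = q^{n-k}(q^k - 1) vectors, and each vector
    -- of (X + Y) \ X was counted q^{n-k} times.
    apply mul_left_cancel₀ (pow_ne_zero (n - codimInter X Y) hq0)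
    rw [← mul_assoc, mul_sub, ← h2, mul_one, ← h1]
    congr 1
    refine Finset.sum_congr ?_ fun _ _ => rfl
    ext v
    simp only [Finset.mem_filter, Finset.mem_univ, true_and, not_not]
    exact and_comm

omit hδ hB in
theorem card_filter_mem_ker [Fintype V] (X : Generator B) {y : V} (hy : y ∉ X.1) :
    (Finset.univ.filter fun v : V => v ∈ X.1 ⊓ LinearMap.ker (B.flip y)).card =
      Fintype.card F ^ (n - 1) := by
  rw [card_filter_mem]
  congr 1
  have hne : B.flip y ∘ₗ X.1.subtype ≠ 0 := by
    intro h
    exact hy (X.mem_of_forall fun x hx => LinearMap.congr_fun h ⟨x, hx⟩)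
  have h1 := Module.Dual.finrank_ker_add_one_of_ne_zero hne
  have h2 : LinearMap.ker (B.flip y ∘ₗ X.1.subtype) =
      (LinearMap.ker (B.flip y)).comap X.1.subtype := LinearMap.ker_comp _ _
  have h3 : Module.finrank F ((LinearMap.ker (B.flip y)).comap X.1.subtype) =
      Module.finrank F (X.1 ⊓ LinearMap.ker (B.flip y) : Submodule F V) := by
    rw [← Submodule.finrank_map_subtype_eq, Submodule.map_comap_subtype]
  rw [X.finrank_eq hV hB', h2, h3] at h1
  omega

omit hδ hB in
theorem sum_mem_ite [Fintype V] (X : Generator B) {y : V} (hy : y ∉ X.1) (α β : ℝ) :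
    ∑ x ∈ Finset.univ.filter (fun v : V => v ∈ X.1), (if B x y = 0 then α else β) =
      (Fintype.card F : ℝ) ^ (n - 1) * α +
        ((Fintype.card F : ℝ) ^ n - (Fintype.card F : ℝ) ^ (n - 1)) * β := by
  have h1 := card_filter_mem_ker hV hB' X hy
  have h2 := Finset.card_filter_add_card_filter_not (s := Finset.univ.filter fun v : V => v ∈ X.1)
    (fun v => B v y = 0)
  have h3 : ((Finset.univ.filter fun v : V => v ∈ X.1).filter fun v => B v y = 0) =
      Finset.univ.filter fun v : V => v ∈ X.1 ⊓ LinearMap.ker (B.flip y) := by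
    rw [Finset.filter_filter]
    ext v
    simp [Submodule.mem_inf]
  rw [h3, h1, card_filter_mem, X.finrank_eq hV hB'] at h2
  rw [Finset.sum_ite, Finset.sum_const, Finset.sum_const, h3, h1, nsmul_eq_mul, nsmul_eq_mul,
    ← Nat.cast_pow, ← Nat.cast_pow, ← h2]
  push_cast
  ring

-- As q is odd there is a nonsquare c, and scaling x by c permutes X and negates the sum.
omit hV hB hB' hδ [FiniteDimensional F V] in
theorem sum_mem_ite_quadraticChar [Fintype V] (hq : Fintype.card F % 4 = 1) (X : Generator B)
    (y : V) (β : ℝ) :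
    ∑ x ∈ Finset.univ.filter (fun v : V => v ∈ X.1),
      (quadraticChar F (B x y) : ℝ) * β = 0 := by
  have hF : ringChar F ≠ 2 := by
    intro h
    have := FiniteField.even_card_iff_char_two.1 h
    omega
  obtain ⟨c, hc⟩ := quadraticChar_exists_neg_one hF
  have hc0 : c ≠ 0 := by
    rintro rfl
    rw [quadraticChar_zero] at hc
    exact absurd hc (by decide)
  set T := ∑ x ∈ Finset.univ.filter (fun v : V => v ∈ X.1),
    (quadraticChar F (B x y) : ℝ) * β with hT
  have h : T = -T := by
    rw [hT, ← Finset.sum_neg_distrib]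
    refine Finset.sum_nbij' (fun x => c⁻¹ • x) (fun x => c • x) ?_ ?_ ?_ ?_ ?_
    · intro x hx
      have hx' := (Finset.mem_filter.1 hx).2
      exact Finset.mem_filter.2 ⟨Finset.mem_univ _, X.1.smul_mem _ hx'⟩
    · intro x hx
      have hx' := (Finset.mem_filter.1 hx).2
      exact Finset.mem_filter.2 ⟨Finset.mem_univ _, X.1.smul_mem _ hx'⟩
    · intro x _
      exact smul_inv_smul₀ hc0 x
    · intro x _
      exact inv_smul_smul₀ hc0 x
    · intro x _
      have : B x y = c * B (c⁻¹ • x) y := by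
        rw [map_smul, LinearMap.smul_apply, smul_eq_mul, mul_inv_cancel_left₀ hc0]
      rw [this, map_mul, hc]
      push_cast
      ring
  linarith

variable (hn : 1 ≤ n)

include hn

/-- The neighbours of `X` counted by their distance from `Y`. -/
theorem sum_neighbours_codimInter (hq : Fintype.card F % 4 = 1) (X Y : Generator B) (g : ℕ → ℝ) :
    ((Fintype.card F : ℝ) - 1) *
        ∑ Z ∈ Finset.univ.filter (fun Z => codimInter X Z = 1), g (codimInter Z Y) =
      ((Fintype.card F : ℝ) ^ (n + 1) - (Fintype.card F : ℝ) ^ (codimInter X Y + 1)) *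
          g (codimInter X Y + 1) +
        ((Fintype.card F : ℝ) ^ codimInter X Y - 1) *
          (g (codimInter X Y - 1) + ((Fintype.card F : ℝ) - 1) * g (codimInter X Y)) := by
  have : Finite V := Module.finite_of_finite F
  have := Fintype.ofFinite V
  have hq0 : (Fintype.card F : ℝ) ≠ 0 := by exact_mod_cast Fintype.card_ne_zero
  have h := sum_neighbours_eq hV hB hB' hδ X Y (fun Z => g (codimInter Z Y))
    (g (codimInter X Y + 1))
    ((Fintype.card F : ℝ) ^ (n - 1) * g (codimInter X Y - 1) +
      ((Fintype.card F : ℝ) ^ n - (Fintype.card F : ℝ) ^ (n - 1)) * g (codimInter X Y))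
    (fun v hv => by
      obtain ⟨u, hu, hu', huv⟩ := exists_mem_inf_of_notMem_sup hV hB' hv
      rw [(neighbour_of_exists_ne_zero hV hB hB' hδ hq X Y hu hu' huv).1])
    (fun y hy hyX => by
      rw [← sum_mem_ite hV hB' X hyX]
      refine Finset.sum_congr rfl fun x hx => ?_
      have hx' := (Finset.mem_filter.1 hx).2
      split_ifs with h
      · rw [Generator.neighbour_add hB hx' (hB.isRefl _ _ h),
          ← (neighbour_of_mem hV hB hB' hδ X Y hy hyX).2.1, Nat.add_sub_cancel]
      · rw [(neighbour_add_of_ne_zero hV hB hB' hδ X Y hy hyX hx' h).1])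
  obtain ⟨m, rfl⟩ : ∃ m, n = m + 1 := ⟨n - 1, by omega⟩
  rw [Nat.add_sub_cancel] at h
  apply mul_left_cancel₀ (pow_ne_zero m hq0)
  linear_combination h

/-- The signed count of the neighbours of `X` by their distance from `Y`. -/
theorem sum_neighbours_maslov (hq : Fintype.card F % 4 = 1) (X Y : Generator B) (g : ℕ → ℝ) :
    ((Fintype.card F : ℝ) - 1) *
        ∑ Z ∈ Finset.univ.filter (fun Z => codimInter X Z = 1),
          ((maslov δ X Z * maslov δ Z Y : ℤˣ) : ℤ) * g (codimInter Z Y) =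
      ((maslov δ X Y : ℤˣ) : ℤ) *
        (((Fintype.card F : ℝ) ^ (n + 1) - (Fintype.card F : ℝ) ^ (codimInter X Y + 1)) *
            g (codimInter X Y + 1) +
          ((Fintype.card F : ℝ) ^ codimInter X Y - 1) * g (codimInter X Y - 1)) := by
  have : Finite V := Module.finite_of_finite F
  have := Fintype.ofFinite V
  have hq0 : (Fintype.card F : ℝ) ≠ 0 := by exact_mod_cast Fintype.card_ne_zero
  have h := sum_neighbours_eq hV hB hB' hδ X Y
    (fun Z => ((maslov δ X Z * maslov δ Z Y : ℤˣ) : ℤ) * g (codimInter Z Y))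
    (((maslov δ X Y : ℤˣ) : ℤ) * g (codimInter X Y + 1))
    ((Fintype.card F : ℝ) ^ (n - 1) * (((maslov δ X Y : ℤˣ) : ℤ) * g (codimInter X Y - 1)))
    (fun v hv => by
      obtain ⟨u, hu, hu', huv⟩ := exists_mem_inf_of_notMem_sup hV hB' hv
      obtain ⟨h1, h2⟩ := neighbour_of_exists_ne_zero hV hB hB' hδ hq X Y hu hu' huv
      rw [h1, h2])
    (fun y hy hyX => by
      have h1 := sum_mem_ite hV hB' X hyX
        (((maslov δ X Y : ℤˣ) : ℤ) * g (codimInter X Y - 1)) 0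
      rw [mul_zero, add_zero] at h1
      have h4 := sum_mem_ite_quadraticChar hq X y
        (((maslov δ X Y : ℤˣ) : ℤ) * g (codimInter X Y))
      -- Because χ(0) = 0, the contributions of B(x,y) = 0 and B(x,y) ≠ 0 can be written as two sums
      -- over all of X; the character sum is zero.
      refine Eq.trans ?_ ((congrArg₂ (· + ·) h1 h4).trans (add_zero _))
      rw [← Finset.sum_add_distrib]
      refine Finset.sum_congr rfl fun x hx => ?_
      have hx' := (Finset.mem_filter.1 hx).2
      split_ifs with h
      · obtain ⟨-, h2, h3⟩ := neighbour_of_mem hV hB hB' hδ X Y hy hyX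
        rw [Generator.neighbour_add hB hx' (hB.isRefl _ _ h), h3, ← h2, Nat.add_sub_cancel, h,
          quadraticChar_zero]
        simp
      · obtain ⟨h2, h3⟩ := neighbour_add_of_ne_zero hV hB hB' hδ X Y hy hyX hx' h
        rw [h2, h3]
        push_cast
        ring)
  obtain ⟨m, rfl⟩ : ∃ m, n = m + 1 := ⟨n - 1, by omega⟩
  rw [Nat.add_sub_cancel] at h
  apply mul_left_cancel₀ (pow_ne_zero m hq0)
  linear_combination h

end NeighbourSums

/-! ### Existence of generators at every distance -/

section Generators

variable {F V : Type*} [Field F] [AddCommGroup V] [Module F V] [FiniteDimensional F V]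
  {B : LinearMap.BilinForm F V}

/-- A maximal totally isotropic subspace W equals its perp: any v in W^⊥ could be adjoined to W,
since B is alternating. -/
theorem nonempty_generator (hB : B.IsAlt) : Nonempty (Generator B) := by
  have hwf : WellFounded fun W W' : Submodule F V => W > W' := wellFounded_gt
  obtain ⟨W, hW, hmax⟩ := hwf.has_min {W : Submodule F V | W ≤ B.orthogonal W}
    ⟨⊥, by rw [Set.mem_ofPred_eq]; exact bot_le⟩
  refine ⟨⟨W, le_antisymm (fun v hv => ?_) hW⟩⟩
  by_contra hvW
  refine hmax (W ⊔ Submodule.span F {v}) ?_ ?_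
  · rw [Set.mem_ofPred_eq]
    intro m hm u hu
    obtain ⟨a, ha, t, ht, rfl⟩ := Submodule.mem_sup.1 hm
    obtain ⟨c, rfl⟩ := Submodule.mem_span_singleton.1 ht
    obtain ⟨b, hb, t', ht', rfl⟩ := Submodule.mem_sup.1 hu
    obtain ⟨e, rfl⟩ := Submodule.mem_span_singleton.1 ht'
    have h1 : B b a = 0 := hW ha b hb
    have h2 : B b v = 0 := hv b hb
    have h3 : B v a = 0 := hB.isRefl _ _ (hv a ha)
    change B (b + e • v) (a + c • v) = 0
    simp only [map_add, map_smul, LinearMap.add_apply, LinearMap.smul_apply, h1, h2, h3, hB v,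
      smul_zero, add_zero]
  · exact lt_of_le_of_ne le_sup_left fun h => hvW (h ▸ Submodule.mem_sup_right
      (Submodule.mem_span_singleton_self v))

theorem exists_codimInter_eq {n : ℕ} (hV : Module.finrank F V = 2 * n) (hB : B.IsAlt)
    (hB' : B.Nondegenerate) {δ : (X : Generator B) → X.1 [⋀^Fin n]→ₗ[F] F} (hδ : ∀ X, δ X ≠ 0)
    [Fintype F] (hq : Fintype.card F % 4 = 1) {k : ℕ} (hk : k ≤ n) :
    ∃ X Y : Generator B, codimInter X Y = k := by
  induction k with
  | zero =>
    obtain ⟨X⟩ := nonempty_generator hB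
    exact ⟨X, X, codimInter_self X⟩
  | succ k ih =>
    obtain ⟨X, Y, h⟩ := ih (by omega)
    have hne : X.1 ⊔ Y.1 ≠ ⊤ := by
      intro htop
      have h1 := finrank_sup_eq hV hB' X Y
      rw [htop, finrank_top, hV] at h1
      omega
    obtain ⟨v, hv⟩ : ∃ v, v ∉ X.1 ⊔ Y.1 := by
      by_contra! hall
      exact hne (Submodule.eq_top_iff'.2 hall)
    obtain ⟨u, hu, hu', huv⟩ := exists_mem_inf_of_notMem_sup hV hB' hv
    exact ⟨_, Y, (neighbour_of_exists_ne_zero hV hB hB' hδ hq X Y hu hu' huv).1.trans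
      (by rw [h])⟩

end Generators

/-! ### Signed and unsigned matrices on the double cover -/

section Matrices

open Matrix Polynomial

variable {F V : Type*} [Field F] [AddCommGroup V] [Module F V] [Fintype F]
  {B : LinearMap.BilinForm F V} {n : ℕ}

variable (B) in
/-- The matrix on the double cover with entries depending on the distance. -/
noncomputable def evenMatrix (g : ℕ → ℝ) : Matrix (Generator B × ℤˣ) (Generator B × ℤˣ) ℝ :=
  Matrix.of fun a b => g (codimInter a.1 b.1)

/-- The matrix on the double cover with entries depending on the distance, signed by the Maslov
index. -/
noncomputable def oddMatrix (δ : (X : Generator B) → X.1 [⋀^Fin n]→ₗ[F] F) (g : ℕ → ℝ) :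
    Matrix (Generator B × ℤˣ) (Generator B × ℤˣ) ℝ :=
  Matrix.of fun a b => ((a.2 * b.2 * maslov δ a.1 b.1 : ℤˣ) : ℤ) * g (codimInter a.1 b.1)

variable {δ : (X : Generator B) → X.1 [⋀^Fin n]→ₗ[F] F}

theorem sum_units_int (f : ℤˣ → ℝ) : ∑ η, f η = f 1 + f (-1) := by
  rw [UnitsInt.univ, Finset.sum_pair (by decide)]

omit [Fintype F] in
theorem evenMatrix_add (g h : ℕ → ℝ) : evenMatrix B (g + h) = evenMatrix B g + evenMatrix B h :=
  rfl

omit [Fintype F] in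
theorem evenMatrix_smul (c : ℝ) (g : ℕ → ℝ) : evenMatrix B (c • g) = c • evenMatrix B g := rfl

theorem oddMatrix_add (g h : ℕ → ℝ) : oddMatrix δ (g + h) = oddMatrix δ g + oddMatrix δ h := by
  ext a b
  exact mul_add _ _ _

theorem oddMatrix_smul (c : ℝ) (g : ℕ → ℝ) : oddMatrix δ (c • g) = c • oddMatrix δ g := by
  ext a b
  exact mul_left_comm _ _ _

variable [FiniteDimensional F V]

/-- The two points over each generator contribute opposite terms. -/
theorem evenMatrix_mul_oddMatrix (g h : ℕ → ℝ) : evenMatrix B g * oddMatrix δ h = 0 := by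
  ext a b
  rw [mul_apply, Fintype.sum_prod_type]
  refine Finset.sum_eq_zero fun Z _ => ?_
  rw [sum_units_int]
  simp [evenMatrix, oddMatrix]

theorem oddMatrix_mul_evenMatrix (g h : ℕ → ℝ) : oddMatrix δ g * evenMatrix B h = 0 := by
  ext a b
  rw [mul_apply, Fintype.sum_prod_type]
  refine Finset.sum_eq_zero fun Z _ => ?_
  rw [sum_units_int]
  simp [evenMatrix, oddMatrix]

theorem sum_oddMatrix (g : ℕ → ℝ) : ∑ a, ∑ b, oddMatrix δ g a b = 0 := by
  refine Finset.sum_eq_zero fun a _ => ?_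
  rw [Fintype.sum_prod_type]
  refine Finset.sum_eq_zero fun Z _ => ?_
  rw [sum_units_int]
  simp [oddMatrix]

variable (hV : Module.finrank F V = 2 * n) (hB : B.IsAlt) (hB' : B.Nondegenerate)
  (hδ : ∀ X, δ X ≠ 0)

include hV hB'

omit [Fintype F] in
theorem evenMatrix_zero_mul [Finite F] (g : ℕ → ℝ) :
    evenMatrix B (Pi.single 0 1) * evenMatrix B g = (2 : ℝ) • evenMatrix B g := by
  ext a b
  rw [mul_apply, Fintype.sum_prod_type, Finset.sum_eq_single a.1]
  · rw [sum_units_int]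
    simp [evenMatrix, codimInter_self]
    ring
  · intro Z _ hZ
    have : codimInter a.1 Z ≠ 0 := fun h => hZ (eq_of_codimInter_eq_zero hV hB' h).symm
    refine Finset.sum_eq_zero fun η _ => ?_
    simp [evenMatrix, this]
  · simp

include hδ

theorem oddMatrix_zero_mul (g : ℕ → ℝ) :
    oddMatrix δ (Pi.single 0 1) * oddMatrix δ g = (2 : ℝ) • oddMatrix δ g := by
  ext a b
  rw [mul_apply, Fintype.sum_prod_type, Finset.sum_eq_single a.1]
  · rw [sum_units_int]
    simp [oddMatrix, codimInter_self, (codimInter_self_and_maslov_self hV hB' hδ a.1).2]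
    ring
  · intro Z _ hZ
    have : codimInter a.1 Z ≠ 0 := fun h => hZ (eq_of_codimInter_eq_zero hV hB' h).symm
    refine Finset.sum_eq_zero fun η _ => ?_
    simp [oddMatrix, this]
  · simp

variable (hn : 1 ≤ n) (hq : Fintype.card F % 4 = 1)

include hB hn hq

/-- The factor 2 counts the two points over each neighbour. At k = 0 the truncated `k - 1` is
harmless, as q^0 - 1 = 0. -/
theorem evenMatrix_one_mul {g g' : ℕ → ℝ}
    (h : ∀ k, ((Fintype.card F : ℝ) - 1) * g' k =
      2 * (((Fintype.card F : ℝ) ^ (n + 1) - (Fintype.card F : ℝ) ^ (k + 1)) * g (k + 1) +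
        ((Fintype.card F : ℝ) ^ k - 1) * (g (k - 1) + ((Fintype.card F : ℝ) - 1) * g k))) :
    evenMatrix B (Pi.single 1 1) * evenMatrix B g = evenMatrix B g' := by
  classical
  have hq1 : (Fintype.card F : ℝ) - 1 ≠ 0 := by
    have : (1 : ℝ) < Fintype.card F := by exact_mod_cast Fintype.one_lt_card
    linarith
  ext a b
  apply mul_left_cancel₀ hq1
  have hs := sum_neighbours_codimInter hV hB hB' hδ hn hq a.1 b.1 g
  refine Eq.trans ?_ (h (codimInter a.1 b.1)).symm
  rw [← hs, mul_left_comm, mul_apply, Fintype.sum_prod_type, Finset.sum_filter,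
    Finset.mul_sum, Finset.mul_sum, Finset.mul_sum]
  refine Finset.sum_congr rfl fun Z _ => ?_
  rw [sum_units_int]
  by_cases hZ : codimInter a.1 Z = 1
  · simp [evenMatrix, hZ]
    exact Or.inl (by ring)
  · simp [evenMatrix, hZ]

theorem oddMatrix_one_mul {g g' : ℕ → ℝ}
    (h : ∀ k, ((Fintype.card F : ℝ) - 1) * g' k =
      2 * (((Fintype.card F : ℝ) ^ (n + 1) - (Fintype.card F : ℝ) ^ (k + 1)) * g (k + 1) +
        ((Fintype.card F : ℝ) ^ k - 1) * g (k - 1))) :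
    oddMatrix δ (Pi.single 1 1) * oddMatrix δ g = oddMatrix δ g' := by
  classical
  have hq1 : (Fintype.card F : ℝ) - 1 ≠ 0 := by
    have : (1 : ℝ) < Fintype.card F := by exact_mod_cast Fintype.one_lt_card
    linarith
  ext a b
  apply mul_left_cancel₀ hq1
  have hs := sum_neighbours_maslov hV hB hB' hδ hn hq a.1 b.1 g
  have hr : ((Fintype.card F : ℝ) - 1) * oddMatrix δ g' a b =
      ((a.2 * b.2 : ℤˣ) : ℤ) * ((maslov δ a.1 b.1 : ℤˣ) : ℤ) *
        (((Fintype.card F : ℝ) - 1) * g' (codimInter a.1 b.1)) := by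
    simp only [oddMatrix, of_apply]
    push_cast
    ring
  rw [hr, h, mul_left_comm, mul_assoc, ← hs]
  rw [mul_apply, Fintype.sum_prod_type, Finset.sum_filter, Finset.mul_sum, Finset.mul_sum,
    Finset.mul_sum, Finset.mul_sum]
  refine Finset.sum_congr rfl fun Z _ => ?_
  rw [sum_units_int]
  by_cases hZ : codimInter a.1 Z = 1
  · simp [oddMatrix, hZ]
    ring
  · simp [oddMatrix, hZ]

end Matrices

/-! ### The relations, and generators of an algebra containing their matrices -/

section Relations

open Matrix Polynomial

variable {F V : Type*} [Field F] [AddCommGroup V] [Module F V] [Fintype F]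
  [FiniteDimensional F V] {B : LinearMap.BilinForm F V} {n : ℕ}
  {δ : (X : Generator B) → X.1 [⋀^Fin n]→ₗ[F] F}

variable (δ) in
/-- The matrices of the dual polar graph and of its signed version, and those of the identity. -/
noncomputable def coverGenerators :
    Set (Matrix (Generator B × ℤˣ) (Generator B × ℤˣ) ℝ) :=
  {evenMatrix B (Pi.single 0 1), evenMatrix B (Pi.single 1 1), oddMatrix δ (Pi.single 0 1),
    oddMatrix δ (Pi.single 1 1)}

variable (hV : Module.finrank F V = 2 * n) (hB : B.IsAlt) (hB' : B.Nondegenerate)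
  (hδ : ∀ X, δ X ≠ 0) (hq : Fintype.card F % 4 = 1)

include hV hB hB' hδ

theorem schemeRel_iff (i : Fin (2 * n + 1 + 1)) (a b : Generator B × ℤˣ) :
    schemeRel δ i a b ↔
      ((i : ℕ) = codimInter a.1 b.1 ∧ a.2 * b.2 = maslov δ a.1 b.1) ∨
        ((i : ℕ) = 2 * n + 1 - codimInter a.1 b.1 ∧ a.2 * b.2 = -maslov δ a.1 b.1) := by
  unfold schemeRel
  rw [dist_eq_codimInter hV hB hB' hδ]
  constructor
  · rintro ⟨k, -, rfl, h⟩
    exact h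
  · intro h
    exact ⟨_, codimInter_le hV hB' a.1 b.1, rfl, h⟩

theorem schemeRel_existsUnique (a b : Generator B × ℤˣ) : ∃! i, schemeRel δ i a b := by
  have hle := codimInter_le hV hB' a.1 b.1
  have hne : ∀ u : ℤˣ, u ≠ -u := by decide
  simp only [schemeRel_iff hV hB hB' hδ]
  have hor : ∀ u v : ℤˣ, u = v ∨ u = -v := by decide
  rcases hor (a.2 * b.2) (maslov δ a.1 b.1) with h | h
  · refine ⟨⟨codimInter a.1 b.1, by omega⟩, Or.inl ⟨rfl, h⟩, ?_⟩
    rintro i (⟨hi, -⟩ | ⟨-, h'⟩)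
    · exact Fin.ext hi
    · exact absurd (h.symm.trans h') (hne _)
  · refine ⟨⟨2 * n + 1 - codimInter a.1 b.1, by omega⟩, Or.inr ⟨rfl, h⟩, ?_⟩
    rintro i (⟨-, h'⟩ | ⟨hi, -⟩)
    · exact absurd (h'.symm.trans h) (hne _)
    · exact Fin.ext hi

theorem schemeRel_zero (a b : Generator B × ℤˣ) : schemeRel δ 0 a b ↔ a = b := by
  have hle := codimInter_le hV hB' a.1 b.1
  rw [schemeRel_iff hV hB hB' hδ, Fin.val_zero]
  constructor
  · rintro (⟨h, h'⟩ | ⟨h, -⟩)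
    · have h1 := eq_of_codimInter_eq_zero hV hB' h.symm
      rw [h1, (codimInter_self_and_maslov_self hV hB' hδ b.1).2] at h'
      refine Prod.ext h1 ?_
      rw [← mul_one a.2, ← Int.units_mul_self b.2, ← mul_assoc, h', one_mul]
    · omega
  · rintro rfl
    left
    rw [codimInter_self, (codimInter_self_and_maslov_self hV hB' hδ a.1).2, Int.units_mul_self]
    exact ⟨rfl, rfl⟩

include hq

theorem schemeRel_symm (i : Fin (2 * n + 1 + 1)) (a b : Generator B × ℤˣ)
    (h : schemeRel δ i a b) : schemeRel δ i b a := by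
  rw [schemeRel_iff hV hB hB' hδ] at h ⊢
  rwa [codimInter_comm hV hB' b.1, maslov_comm hV hB hB' hδ hq b.1, mul_comm b.2]

theorem schemeRel_nonempty (i : Fin (2 * n + 1 + 1)) : ∃ a b, schemeRel δ i a b := by
  have hi := i.2
  by_cases h : (i : ℕ) ≤ n
  · obtain ⟨X, Y, hXY⟩ := exists_codimInter_eq hV hB hB' hδ hq h
    refine ⟨(X, 1), (Y, maslov δ X Y), ?_⟩
    rw [schemeRel_iff hV hB hB' hδ]
    exact Or.inl ⟨hXY.symm, one_mul _⟩
  · obtain ⟨X, Y, hXY⟩ := exists_codimInter_eq hV hB hB' hδ hq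
      (k := 2 * n + 1 - i) (by omega)
    refine ⟨(X, 1), (Y, -maslov δ X Y), ?_⟩
    rw [schemeRel_iff hV hB hB' hδ]
    refine Or.inr ⟨?_, one_mul _⟩
    simp only [hXY]
    omega

omit hq in
theorem oddMatrix_eq_qSequence (r : ℝ) (i : Fin (2 * n + 1 + 1)) (a b : Generator B × ℤˣ)
    (h : schemeRel δ i a b) :
    oddMatrix δ (fun k => (r ^ k)⁻¹) a b = qSequence n r i := by
  have hle := codimInter_le hV hB' a.1 b.1
  rw [schemeRel_iff hV hB hB' hδ] at h
  unfold oddMatrix qSequence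
  rw [of_apply]
  rcases h with ⟨h, h'⟩ | ⟨h, h'⟩
  · rw [h', Int.units_mul_self, if_pos (by omega), h]
    simp
  · have h2 : 2 * n + 1 - (i : ℕ) = codimInter a.1 b.1 := by omega
    rw [h', neg_mul, Int.units_mul_self, if_neg (by omega), h2]
    simp

-- Half the sum and half the difference of the unsigned and signed matrices at distance k are the
-- indicators of the two relations over k.
omit hq in
theorem adjacencyMatrix_eq (i : Fin (2 * n + 1 + 1)) :
    ∃ (k : ℕ) (s : ℝ), adjacencyMatrix (schemeRel δ) i =
      (1 / 2 : ℝ) • evenMatrix B (Pi.single k 1) + s • oddMatrix δ (Pi.single k 1) := by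
  have hi := i.2
  have hor : ∀ u v : ℤˣ, u = v ∨ u = -v := by decide
  have hone : ∀ u : ℤˣ, u ≠ -u := by decide
  have hone' : ∀ u : ℤˣ, -u ≠ u := by decide
  by_cases h : (i : ℕ) ≤ n
  · refine ⟨i, 1 / 2, ?_⟩
    ext a b
    have hle := codimInter_le hV hB' a.1 b.1
    have hne : (i : ℕ) ≠ 2 * n + 1 - codimInter a.1 b.1 := by omega
    simp only [adjacencyMatrix, evenMatrix, oddMatrix, of_apply, Matrix.add_apply,
      Matrix.smul_apply, schemeRel_iff hV hB hB' hδ, smul_eq_mul, Pi.single_apply]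
    by_cases hc : codimInter a.1 b.1 = i
    · rcases hor (a.2 * b.2) (maslov δ a.1 b.1) with h' | h'
      · rw [h', Int.units_mul_self]
        simp [hc]
        norm_num
      · rw [h', neg_mul, Int.units_mul_self]
        simp [hc, hone']
        omega
    · simp [hc, hne, Ne.symm hc]
  · refine ⟨2 * n + 1 - i, -(1 / 2), ?_⟩
    ext a b
    have hle := codimInter_le hV hB' a.1 b.1
    have hne : (i : ℕ) ≠ codimInter a.1 b.1 := by omega
    have hiff : (i : ℕ) = 2 * n + 1 - codimInter a.1 b.1 ↔
      codimInter a.1 b.1 = 2 * n + 1 - i := by omega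
    simp only [adjacencyMatrix, evenMatrix, oddMatrix, of_apply, Matrix.add_apply,
      Matrix.smul_apply, schemeRel_iff hV hB hB' hδ, smul_eq_mul, Pi.single_apply, hiff]
    by_cases hc : codimInter a.1 b.1 = 2 * n + 1 - i
    · rcases hor (a.2 * b.2) (maslov δ a.1 b.1) with h' | h'
      · rw [h', Int.units_mul_self]
        simp only [hc, hone, and_false, or_false, if_true]
        simp
        omega
      · have e : -maslov δ a.1 b.1 * maslov δ a.1 b.1 = -1 := by rw [neg_mul, Int.units_mul_self]
        rw [h', e]
        simp only [hc, true_and, if_true]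
        simp
        norm_num
    · simp [hc, hne]

variable (hn : 1 ≤ n)

include hn hq

/-- The three-term recurrence for the distance matrices is solved for its top term. Here α, β, γ are
twice the intersection numbers c_{k+2}, a_{k+1}, b_k. As α never vanishes, k needs no bound; past
the diameter the matrices are zero. -/
theorem evenMatrix_single_mem_adjoin [DecidableEq (Generator B × ℤˣ)] (k : ℕ) :
    evenMatrix B (Pi.single k 1) ∈ Algebra.adjoin ℝ (coverGenerators δ) ∧
      evenMatrix B (Pi.single (k + 1) 1) ∈ Algebra.adjoin ℝ (coverGenerators δ) := by
  have hq1 : (1 : ℝ) < Fintype.card F := by exact_mod_cast Fintype.one_lt_card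
  have hq0 : (Fintype.card F : ℝ) - 1 ≠ 0 := by linarith
  have h1 : evenMatrix B (Pi.single 1 1) ∈ Algebra.adjoin ℝ (coverGenerators δ) :=
    Algebra.subset_adjoin (by simp [coverGenerators])
  induction k with
  | zero => exact ⟨Algebra.subset_adjoin (by simp [coverGenerators]), h1⟩
  | succ k ih =>
    refine ⟨ih.2, ?_⟩
    set q : ℝ := (Fintype.card F : ℝ) with hqdef
    set α : ℝ := 2 * (q ^ (k + 2) - 1) / (q - 1) with hα
    set β : ℝ := 2 * (q ^ (k + 1) - 1) with hβ
    set γ : ℝ := 2 * (q ^ (n + 1) - q ^ (k + 1)) / (q - 1) with hγ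
    have hα0 : α ≠ 0 := by
      have : 1 < q ^ (k + 2) := one_lt_pow₀ hq1 (by omega)
      rw [hα]
      exact div_ne_zero (mul_ne_zero two_ne_zero (by linarith)) hq0
    have hmul := evenMatrix_one_mul hV hB hB' hδ hn hq
      (g := Pi.single (k + 1) 1)
      (g' := α • Pi.single (k + 2) 1 + (β • Pi.single (k + 1) 1 + γ • Pi.single k 1)) (by
        intro m
        rw [← hqdef]
        simp only [Pi.add_apply, Pi.smul_apply, smul_eq_mul, Pi.single_apply]
        have hα' : (q - 1) * α = 2 * (q ^ (k + 2) - 1) := by rw [hα]; field_simp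
        have hγ' : (q - 1) * γ = 2 * (q ^ (n + 1) - q ^ (k + 1)) := by rw [hγ]; field_simp
        rcases eq_or_ne m (k + 2) with rfl | hm2
        · have e1 : k + 2 - 1 = k + 1 := by omega
          simp only [e1, if_true, show k + 2 ≠ k + 1 by omega, show k + 2 ≠ k by omega,
            show k + 2 + 1 ≠ k + 1 by omega, if_false]
          linear_combination hα'
        · rcases eq_or_ne m (k + 1) with rfl | hm1
          · simp only [if_true, hm2, show k + 1 ≠ k by omega, show k + 1 + 1 ≠ k + 1 by omega,
              show k + 1 - 1 ≠ k + 1 by omega, if_false]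
            rw [hβ]
            ring
          · rcases eq_or_ne m k with rfl | hm0
            · simp only [hm2, hm1, show m - 1 ≠ m + 1 by omega, if_true, if_false]
              linear_combination hγ'
            · simp only [hm2, hm1, hm0, show m + 1 ≠ k + 1 by omega,
                show m - 1 ≠ k + 1 by omega, if_false]
              ring)
    rw [evenMatrix_add, evenMatrix_add, evenMatrix_smul, evenMatrix_smul, evenMatrix_smul] at hmul
    have hm := Subalgebra.mul_mem _ h1 ih.2
    rw [hmul] at hm
    have hrest := Subalgebra.add_mem _ (Subalgebra.smul_mem _ ih.2 β)
      (Subalgebra.smul_mem _ ih.1 γ)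
    have h2 := Subalgebra.smul_mem _ (Subalgebra.sub_mem _ hm hrest) α⁻¹
    rwa [add_sub_cancel_right, smul_smul, inv_mul_cancel₀ hα0, one_smul] at h2

theorem oddMatrix_single_mem_adjoin [DecidableEq (Generator B × ℤˣ)] (k : ℕ) :
    oddMatrix δ (Pi.single k 1) ∈ Algebra.adjoin ℝ (coverGenerators δ) ∧
      oddMatrix δ (Pi.single (k + 1) 1) ∈ Algebra.adjoin ℝ (coverGenerators δ) := by
  have hq1 : (1 : ℝ) < Fintype.card F := by exact_mod_cast Fintype.one_lt_card
  have hq0 : (Fintype.card F : ℝ) - 1 ≠ 0 := by linarith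
  have h1 : oddMatrix δ (Pi.single 1 1) ∈ Algebra.adjoin ℝ (coverGenerators δ) :=
    Algebra.subset_adjoin (by simp [coverGenerators])
  induction k with
  | zero => exact ⟨Algebra.subset_adjoin (by simp [coverGenerators]), h1⟩
  | succ k ih =>
    refine ⟨ih.2, ?_⟩
    set q : ℝ := (Fintype.card F : ℝ) with hqdef
    set α : ℝ := 2 * (q ^ (k + 2) - 1) / (q - 1) with hα
    set γ : ℝ := 2 * (q ^ (n + 1) - q ^ (k + 1)) / (q - 1) with hγ
    have hα0 : α ≠ 0 := by
      have : 1 < q ^ (k + 2) := one_lt_pow₀ hq1 (by omega)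
      rw [hα]
      exact div_ne_zero (mul_ne_zero two_ne_zero (by linarith)) hq0
    have hmul := oddMatrix_one_mul hV hB hB' hδ hn hq
      (g := Pi.single (k + 1) 1)
      (g' := α • Pi.single (k + 2) 1 + γ • Pi.single k 1) (by
        intro m
        rw [← hqdef]
        simp only [Pi.add_apply, Pi.smul_apply, smul_eq_mul, Pi.single_apply]
        have hα' : (q - 1) * α = 2 * (q ^ (k + 2) - 1) := by rw [hα]; field_simp
        have hγ' : (q - 1) * γ = 2 * (q ^ (n + 1) - q ^ (k + 1)) := by rw [hγ]; field_simp
        rcases eq_or_ne m (k + 2) with rfl | hm2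
        · have e1 : k + 2 - 1 = k + 1 := by omega
          simp only [e1, if_true, show k + 2 ≠ k by omega,
            show k + 2 + 1 ≠ k + 1 by omega, if_false]
          linear_combination hα'
        · rcases eq_or_ne m k with rfl | hm0
          · simp only [hm2, show m - 1 ≠ m + 1 by omega, if_true, if_false]
            linear_combination hγ'
          · simp only [hm2, hm0, show m + 1 ≠ k + 1 by omega,
              show m - 1 ≠ k + 1 by omega, if_false]
            ring)
    rw [oddMatrix_add, oddMatrix_smul, oddMatrix_smul] at hmul
    have hm := Subalgebra.mul_mem _ h1 ih.2
    rw [hmul] at hm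
    have h2 := Subalgebra.smul_mem _
      (Subalgebra.sub_mem _ hm (Subalgebra.smul_mem _ ih.1 γ)) α⁻¹
    rwa [add_sub_cancel_right, smul_smul, inv_mul_cancel₀ hα0, one_smul] at h2

theorem boseMesner_le_adjoin [DecidableEq (Generator B × ℤˣ)] {A : Matrix _ _ ℝ}
    (hA : A ∈ boseMesner (schemeRel δ)) : A ∈ Algebra.adjoin ℝ (coverGenerators δ) := by
  have hle : boseMesner (schemeRel δ) ≤
      Subalgebra.toSubmodule (Algebra.adjoin ℝ (coverGenerators δ)) := by
    refine Submodule.span_le.2 ?_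
    rintro _ ⟨i, rfl⟩
    obtain ⟨k, s, h⟩ := adjacencyMatrix_eq hV hB hB' hδ i
    rw [h]
    exact Subalgebra.add_mem _
      (Subalgebra.smul_mem _ (evenMatrix_single_mem_adjoin hV hB hB' hδ hq hn k).1 _)
      (Subalgebra.smul_mem _ (oddMatrix_single_mem_adjoin hV hB hB' hδ hq hn k).1 _)
  exact hle hA

end Relations

/-! ### Triangular action on the powers of S, and the two orderings -/

section Ordering

open Matrix Polynomial

variable {F V : Type*} [Field F] [AddCommGroup V] [Module F V] [Fintype F]
  {B : LinearMap.BilinForm F V} {n : ℕ} {δ : (X : Generator B) → X.1 [⋀^Fin n]→ₗ[F] F} {r : ℝ}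

theorem entrywise_pow_of_even {j : ℕ} (hj : Even j) :
    entrywise (oddMatrix δ fun k => (r ^ k)⁻¹) (X ^ j) =
      evenMatrix B fun k => (r ^ j)⁻¹ ^ k := by
  ext a b
  rw [entrywise_apply, eval_pow, eval_X]
  simp only [oddMatrix, evenMatrix, of_apply, mul_pow]
  rcases Int.units_eq_one_or (a.2 * b.2 * maslov δ a.1 b.1) with h | h <;> rw [h] <;>
    simp [hj.neg_one_pow, ← pow_mul, mul_comm]

theorem entrywise_pow_of_odd {j : ℕ} (hj : Odd j) :
    entrywise (oddMatrix δ fun k => (r ^ k)⁻¹) (X ^ j) =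
      oddMatrix δ fun k => (r ^ j)⁻¹ ^ k := by
  ext a b
  rw [entrywise_apply, eval_pow, eval_X]
  simp only [oddMatrix, of_apply, mul_pow]
  rcases Int.units_eq_one_or (a.2 * b.2 * maslov δ a.1 b.1) with h | h <;> rw [h] <;>
    simp [hj.neg_one_pow, ← pow_mul, mul_comm]

variable [FiniteDimensional F V] (hV : Module.finrank F V = 2 * n) (hB : B.IsAlt)
  (hB' : B.Nondegenerate) (hδ : ∀ X, δ X ≠ 0) (hq : Fintype.card F % 4 = 1) (hn : 1 ≤ n)
  (hr : r ^ 2 = Fintype.card F)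

theorem powerFlag_eq_span {Ω : Type*} (S : Matrix Ω Ω ℝ) (m : ℕ) :
    powerFlag S m = Submodule.span ℝ {A | ∃ j < m, A = entrywise S (X ^ j)} := by
  classical
  unfold powerFlag
  rw [degreeLT_eq_span_X_pow, Submodule.map_span]
  congr 1
  ext A
  simp [eq_comm]

theorem entrywise_X_pow_mem {Ω : Type*} (S : Matrix Ω Ω ℝ) {j m : ℕ} (h : j < m) :
    entrywise S (X ^ j) ∈ powerFlag S m :=
  entrywise_mem_powerFlag S (by rw [degree_X_pow]; exact_mod_cast h)

include hV hB hB' hδ hq hn hr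

/-- The generators of the algebra act triangularly on the entrywise powers. -/
theorem coverGenerators_mul_mem {A : Matrix _ _ ℝ} (hA : A ∈ coverGenerators δ) (m : ℕ)
    {C : Matrix _ _ ℝ} (hC : C ∈ powerFlag (oddMatrix δ fun k => (r ^ k)⁻¹) m) :
    A * C ∈ powerFlag (oddMatrix δ fun k => (r ^ k)⁻¹) m := by
  have hq1 : (1 : ℝ) < Fintype.card F := by exact_mod_cast Fintype.one_lt_card
  set q : ℝ := (Fintype.card F : ℝ) with hqdef
  have hq0 : q - 1 ≠ 0 := by linarith
  have hr0 : r ≠ 0 := by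
    rintro rfl
    norm_num at hr
    linarith
  set S := oddMatrix δ fun k => (r ^ k)⁻¹ with hS
  -- At k = 0 the truncated exponent does no damage, because the factor q^k - 1 vanishes.
  have hpow : ∀ (ρ : ℝ), ρ ≠ 0 → ∀ k, (q ^ k - 1) * ρ ^ (k - 1) = (q ^ k - 1) * ρ⁻¹ * ρ ^ k := by
    intro ρ hρ k
    cases k with
    | zero => simp
    | succ k =>
      rw [Nat.add_sub_cancel]
      field_simp
      ring
  have hstep : ∀ j, q * (r ^ (j + 2))⁻¹ = (r ^ j)⁻¹ := by
    intro j
    rw [← hr]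
    field_simp
    ring
  have key : ∀ j < m, A * entrywise S (X ^ j) ∈ powerFlag S m := by
    intro j hj
    have hρ0 : (r ^ j)⁻¹ ≠ 0 := inv_ne_zero (pow_ne_zero j hr0)
    have hTj := entrywise_X_pow_mem S hj
    rcases Nat.even_or_odd j with hj' | hj'
    · rw [hS, entrywise_pow_of_even hj'] at hTj ⊢
      set ρ := (r ^ j)⁻¹ with hρ
      rcases hA with rfl | rfl | rfl | rfl
      · rw [evenMatrix_zero_mul hV hB']
        exact Submodule.smul_mem _ _ hTj
      · set β := 2 * (ρ⁻¹ + q - 1 - q * ρ) / (q - 1) with hβ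
        -- The new base qρ is r^{-(j-2)}, an even power of lower exponent. For j = 0 there is none,
        -- but ρ = 1 gives β = 0.
        have hlow : β • evenMatrix B (fun k => (q * ρ) ^ k) ∈ powerFlag S m := by
          rcases lt_or_ge j 2 with hj2 | hj2
          · have hj0 : j = 0 := by
              obtain ⟨t, rfl⟩ := hj'
              omega
            have : β = 0 := by
              rw [hβ, hρ, hj0]
              norm_num
            rw [this, zero_smul]
            exact Submodule.zero_mem _
          · obtain ⟨i, rfl⟩ := Nat.exists_eq_add_of_le' hj2
            rw [hρ, hstep, ← entrywise_pow_of_even (by simpa [Nat.even_add] using hj')]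
            exact Submodule.smul_mem _ _ (entrywise_X_pow_mem S (by omega))
        have hmul := evenMatrix_one_mul hV hB hB' hδ hn hq (g := fun k => ρ ^ k)
          (g' := (2 * (q ^ (n + 1) * ρ - ρ⁻¹ - (q - 1)) / (q - 1)) • (fun k => ρ ^ k) +
            β • fun k => (q * ρ) ^ k) (by
            intro k
            rw [← hqdef]
            simp only [Pi.add_apply, Pi.smul_apply, smul_eq_mul]
            have h1 := hpow ρ hρ0 k
            have h2 : (q - 1) * β = 2 * (ρ⁻¹ + q - 1 - q * ρ) := by rw [hβ]; field_simp
            have h3 : (q - 1) * (2 * (q ^ (n + 1) * ρ - ρ⁻¹ - (q - 1)) / (q - 1)) =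
              2 * (q ^ (n + 1) * ρ - ρ⁻¹ - (q - 1)) := by field_simp
            rw [mul_pow]
            linear_combination ρ ^ k * h3 + q ^ k * ρ ^ k * h2 - 2 * h1)
        rw [hmul, evenMatrix_add, evenMatrix_smul, evenMatrix_smul]
        exact Submodule.add_mem _ (Submodule.smul_mem _ _ hTj) hlow
      · rw [oddMatrix_mul_evenMatrix]
        exact Submodule.zero_mem _
      · rw [oddMatrix_mul_evenMatrix]
        exact Submodule.zero_mem _
    · rw [hS, entrywise_pow_of_odd hj'] at hTj ⊢
      set ρ := (r ^ j)⁻¹ with hρ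
      rcases hA with rfl | rfl | rfl | rfl
      · rw [evenMatrix_mul_oddMatrix]
        exact Submodule.zero_mem _
      · rw [evenMatrix_mul_oddMatrix]
        exact Submodule.zero_mem _
      · rw [oddMatrix_zero_mul hV hB' hδ]
        exact Submodule.smul_mem _ _ hTj
      · set β := 2 * (ρ⁻¹ - q * ρ) / (q - 1) with hβ
        -- For j = 1 the lower exponent would be negative, but ρ⁻¹ = r and qρ = r²/r = r, so β = 0.
        -- This holds for either root r of q.
        have hlow : β • oddMatrix δ (fun k => (q * ρ) ^ k) ∈ powerFlag S m := by
          rcases lt_or_ge j 2 with hj2 | hj2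
          · have hj0 : j = 1 := by
              obtain ⟨t, rfl⟩ := hj'
              omega
            have : β = 0 := by
              rw [hβ, hρ, hj0, ← hr]
              field_simp
              norm_num
            rw [this, zero_smul]
            exact Submodule.zero_mem _
          · obtain ⟨i, rfl⟩ := Nat.exists_eq_add_of_le' hj2
            rw [hρ, hstep, ← entrywise_pow_of_odd (by simpa [Nat.odd_add] using hj')]
            exact Submodule.smul_mem _ _ (entrywise_X_pow_mem S (by omega))
        have hmul := oddMatrix_one_mul hV hB hB' hδ hn hq (g := fun k => ρ ^ k)
          (g' := (2 * (q ^ (n + 1) * ρ - ρ⁻¹) / (q - 1)) • (fun k => ρ ^ k) +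
            β • fun k => (q * ρ) ^ k) (by
            intro k
            rw [← hqdef]
            simp only [Pi.add_apply, Pi.smul_apply, smul_eq_mul]
            have h1 := hpow ρ hρ0 k
            have h2 : (q - 1) * β = 2 * (ρ⁻¹ - q * ρ) := by rw [hβ]; field_simp
            have h3 : (q - 1) * (2 * (q ^ (n + 1) * ρ - ρ⁻¹) / (q - 1)) =
              2 * (q ^ (n + 1) * ρ - ρ⁻¹) := by field_simp
            rw [mul_pow]
            linear_combination ρ ^ k * h3 + q ^ k * ρ ^ k * h2 - 2 * h1)
        rw [hmul, oddMatrix_add, oddMatrix_smul, oddMatrix_smul]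
        exact Submodule.add_mem _ (Submodule.smul_mem _ _ hTj) hlow
  rw [powerFlag_eq_span] at hC
  induction hC using Submodule.span_induction with
  | mem C hC =>
    obtain ⟨j, hj, rfl⟩ := hC
    exact key j hj
  | zero => rw [Matrix.mul_zero]; exact Submodule.zero_mem _
  | add C C' _ _ hC hC' => rw [Matrix.mul_add]; exact Submodule.add_mem _ hC hC'
  | smul c C _ hC => rw [Matrix.mul_smul]; exact Submodule.smul_mem _ _ hC

-- As |r| > 1, the absolute value determines the exponent, and the sign then tells the two halves of
-- the sequence apart.
omit [FiniteDimensional F V] hV hB hB' hδ hq hn in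
theorem qSequence_injective :
    Function.Injective fun i : Fin (2 * n + 1 + 1) => qSequence n r i := by
  have hq1 : (1 : ℝ) < Fintype.card F := by exact_mod_cast Fintype.one_lt_card
  have hr1 : 1 < |r| := by
    rw [← hr, ← sq_abs] at hq1
    exact (one_lt_sq_iff₀ (abs_nonneg r)).1 hq1
  have hr0 : r ≠ 0 := by
    rintro rfl
    norm_num at hr1
  have hinj : ∀ {s t : ℕ}, |(r ^ s)⁻¹| = |(r ^ t)⁻¹| → s = t := by
    intro s t h
    rw [abs_inv, abs_inv, _root_.inv_inj, abs_pow, abs_pow] at h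
    exact pow_right_injective₀ (by linarith) hr1.ne' h
  have hne : ∀ s : ℕ, (r ^ s)⁻¹ ≠ -(r ^ s)⁻¹ := fun s h =>
    inv_ne_zero (pow_ne_zero s hr0) (by linarith)
  intro i j h
  have hi := i.2
  have hj := j.2
  simp only [qSequence] at h
  apply Fin.ext
  split_ifs at h with h1 h2 h2
  · exact hinj (by rw [h])
  · have := hinj (by rw [h, abs_neg] : |(r ^ (i : ℕ))⁻¹| = |(r ^ (2 * n + 1 - (j : ℕ)))⁻¹|)
    rw [← this] at h
    exact absurd h (hne _)
  · have := hinj (by rw [← h, abs_neg] : |(r ^ (j : ℕ))⁻¹| = |(r ^ (2 * n + 1 - (i : ℕ)))⁻¹|)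
    rw [← this] at h
    exact absurd h.symm (hne _)
  · have := hinj (by rw [← abs_neg, h, abs_neg] :
      |(r ^ (2 * n + 1 - (i : ℕ)))⁻¹| = |(r ^ (2 * n + 1 - (j : ℕ)))⁻¹|)
    omega

theorem boseMesner_mul_mem_powerFlag {A : Matrix _ _ ℝ} (hA : A ∈ boseMesner (schemeRel δ))
    (m : ℕ) {C : Matrix _ _ ℝ} (hC : C ∈ powerFlag (oddMatrix δ fun k => (r ^ k)⁻¹) m) :
    A * C ∈ powerFlag (oddMatrix δ fun k => (r ^ k)⁻¹) m := by
  classical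
  exact adjoin_mul_mem
    (fun A hA C hC => coverGenerators_mul_mem hV hB hB' hδ hq hn hr hA m hC)
    (boseMesner_le_adjoin hV hB hB' hδ hq hn hA) hC

theorem isAssociationScheme_schemeRel : IsAssociationScheme (schemeRel δ) := by
  have hpart := schemeRel_existsUnique hV hB hB' hδ
  have hS := oddMatrix_eq_qSequence hV hB hB' hδ r
  refine isAssociationScheme_of_mul_mem hpart (schemeRel_nonempty hV hB hB' hδ hq)
    (schemeRel_zero hV hB hB' hδ) (schemeRel_symm hV hB hB' hδ hq) fun A hA C hC => ?_
  exact powerFlag_le_boseMesner (θ := fun i => qSequence n r i) hpart hS _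
    (boseMesner_mul_mem_powerFlag hV hB hB' hδ hq hn hr hA _
      (boseMesner_le_powerFlag (θ := fun i => qSequence n r i) hpart hS
        (qSequence_injective hr) hC))

theorem exists_isQPolynomialOrdering_schemeRel :
    ∃ E, IsQPolynomialOrdering (schemeRel δ) E ∧
      ∀ k a b, schemeRel δ k a b → E 1 a b = E 1 a a * qSequence n r k :=
  exists_isQPolynomialOrdering (θ := fun i => qSequence n r i) (by omega)
    (schemeRel_existsUnique hV hB hB' hδ) (schemeRel_nonempty hV hB hB' hδ hq)
    (schemeRel_zero hV hB hB' hδ) (schemeRel_symm hV hB hB' hδ hq)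
    (oddMatrix_eq_qSequence hV hB hB' hδ r) (qSequence_injective hr) (by simp [qSequence])
    (sum_oddMatrix _)
    (fun _ hA m _ hC => boseMesner_mul_mem_powerFlag hV hB hB' hδ hq hn hr hA m hC)

end Ordering

theorem theorem7p2 {F V : Type*} [Field F] [Fintype F] [AddCommGroup V] [Module F V]
    [FiniteDimensional F V] (n : ℕ) (hn : 1 ≤ n) (hV : Module.finrank F V = 2 * n)
    (hq : Fintype.card F % 4 = 1)
    (B : LinearMap.BilinForm F V) (hB : B.IsAlt) (hB' : B.Nondegenerate)
    (δ : (X : Generator B) → X.1 [⋀^Fin n]→ₗ[F] F) (hδ : ∀ X, δ X ≠ 0) :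
    IsAssociationScheme (schemeRel δ) ∧
    IsQPolynomial (schemeRel δ) ∧
    ∃ E E' : Fin (2 * n + 1 + 1) → Matrix (Generator B × ℤˣ) (Generator B × ℤˣ) ℝ,
      IsQPolynomialOrdering (schemeRel δ) E ∧
      IsQPolynomialOrdering (schemeRel δ) E' ∧
      E ≠ E' ∧
      (∀ k a b, schemeRel δ k a b →
        E 1 a b = E 1 a a * qSequence n (√(Fintype.card F : ℝ)) k) ∧
      (∀ k a b, schemeRel δ k a b →
        E' 1 a b = E' 1 a a * qSequence n (-√(Fintype.card F : ℝ)) k) := by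
  have hsq : √(Fintype.card F : ℝ) ^ 2 = Fintype.card F := Real.sq_sqrt (Nat.cast_nonneg _)
  have hsq' : (-√(Fintype.card F : ℝ)) ^ 2 = Fintype.card F := by rw [neg_sq, hsq]
  obtain ⟨E, hE, hE1⟩ := exists_isQPolynomialOrdering_schemeRel hV hB hB' hδ hq hn hsq
  obtain ⟨E', hE', hE1'⟩ := exists_isQPolynomialOrdering_schemeRel hV hB hB' hδ hq hn hsq'
  refine ⟨isAssociationScheme_schemeRel hV hB hB' hδ hq hn hsq, ⟨E, hE⟩, E, E', hE, hE', ?_,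
    hE1, hE1'⟩
  rintro rfl
  have hpart := schemeRel_existsUnique hV hB hB' hδ
  obtain ⟨a, b, hab⟩ := schemeRel_nonempty hV hB hB' hδ hq 1
  -- E_1 has constant diagonal and all its entries are multiples of the diagonal one, so a zero
  -- diagonal would force E_1 = 0. On R_1 the two orderings would then give 1/√q = -1/√q.
  have hdiag : E 1 a a ≠ 0 := by
    intro h0
    apply hE.1.ne_zero 1
    ext x y
    obtain ⟨k, hk, -⟩ := hpart x y
    rw [hE1 k x y hk, eq_of_mem_boseMesner hpart (hE.1.mem 1)
      ((schemeRel_zero hV hB hB' hδ x x).2 rfl) ((schemeRel_zero hV hB hB' hδ a a).2 rfl), h0,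
      zero_mul, Matrix.zero_apply]
  have h := mul_left_cancel₀ hdiag ((hE1 1 a b hab).symm.trans (hE1' 1 a b hab))
  have hpos : 0 < √(Fintype.card F : ℝ) :=
    Real.sqrt_pos.2 (by exact_mod_cast Fintype.card_pos)
  simp only [qSequence, Fin.val_one, if_pos hn, pow_one, inv_neg] at h
  have := inv_pos.2 hpos
  linarith
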